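/- Let $M$ be a smooth $n$-manifold and let $\{g_s(t)\}$, $|s|<\varepsilon$, $t\in[0,T_s)$ with $0<T_s\le T_0$, be a one-parameter family of smooth Riemannian metrics on $M$ which is jointly smooth in $s$, $t$ and the point of $M$ (up to $t=0$). Assume that $g_0(t)$, $t\in[0,T_0)$, is a solution of the Ricci flow $\frac{\partial}{\partial t}g_{ij}=-2R_{ij}$, and that each $g_s(t)$, $t\in[0,T_s)$, is a solution of DeTurck's modified Ricci flow with time-dependent background metric $g_0(t)$, $$\frac{\partial}{\partial t}(g_s)_{ij}=-2R_{ij}+\nabla_iW_j+\nabla_jW_i,\qquad W_\ell=(g_s)_{\ell k}(g_s)^{ij}\left(\Gamma[g_s]^k_{ij}-\Gamma[g_0]^k_{ij}\right),$$ where the Ricci tensor and the covariant derivatives are those of $g_s(t)$. Let $[0,T')$ be a time interval on which the variation makes sense, i.e. such that for each $t\in[0,T')$ one has $t<T_s$ for all $s$ close to $0$. Then the variation $v(t)=\frac{\partial}{\partial s}\big|_{s=0}g_s(t)$ exists for $t\in[0,T')$, is a smooth family of symmetric $2$-tensors, and satisfies the Lichnerowicz Laplacian heat equation $$\frac{\partial}{\partial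 t}v_{ij}=(\Delta_Lv)_{ij}=\Delta v_{ij}+2R_{kijl}v_{kl}-R_{ik}v_{kj}-R_{jk}v_{ki}\quad\text{on } M\times[0,T'),$$ where $\Delta_L$ is taken with respect to $g_0(t)$, repeated indices are contracted with $g_0(t)$, and the curvature convention is $R_{jk}=g^{il}R_{ijkl}$ (so $R_{ijji}>0$ on round spheres). Time derivatives at $t=0$ are one-sided. That is, $(g_0,v)$ satisfies the linearized Ricci flow system on $[0,T')$, consisting of the Ricci flow equation for $g_0$ and the equation $\frac{\partial}{\partial t}v=\Delta_Lv$; if the metrics $g_0(t)$ are complete, then $(g_0,v)$ is a solution of this system in the strict sense in which completeness of $g_0(t)$ is part of the definition. -/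

import Mathlib

open scoped Manifold ContDiff Topology Bundle
open Set Filter

noncomputable section

namespace LinRF

/-! ### Tensor calculus in local coordinates

A metric in local coordinates is a matrix-valued function `G` on the coordinate space `ℝⁿ`
(only its values on the open coordinate domain matter), a symmetric `2`-tensor is a matrix-valued
function `h`, and a `1`-form is a vector-valued function `W`. -/

/-- The coordinate space `ℝⁿ`. -/
abbrev Coord (n : ℕ) : Type := EuclideanSpace ℝ (Fin n)

variable {n : ℕ}

/-- The partial derivative `∂ₖ f` at `y`. -/
def pd (k : Fin n) (f : Coord n → ℝ) (y : Coord n) : ℝ :=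
  fderiv ℝ f y (EuclideanSpace.single k 1)

/-- The Christoffel symbols
`Γᵏᵢⱼ = ½ gᵏˡ (∂ᵢ gⱼₗ + ∂ⱼ gᵢₗ - ∂ₗ gᵢⱼ)` of the Levi-Civita connection of `G`. -/
def christoffel (G : Coord n → Matrix (Fin n) (Fin n) ℝ) (k i j : Fin n) (y : Coord n) : ℝ :=
  (1 / 2) * ∑ l, (G y)⁻¹ k l *
    (pd i (fun z => G z j l) y + pd j (fun z => G z i l) y - pd l (fun z => G z i j) y)

/-- The covariant derivative `∇ᵢ Wⱼ` of a `1`-form. -/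
def covOneForm (G : Coord n → Matrix (Fin n) (Fin n) ℝ) (W : Coord n → Fin n → ℝ)
    (i j : Fin n) (y : Coord n) : ℝ :=
  pd i (fun z => W z j) y - ∑ m, christoffel G m i j y * W y m

/-- The covariant derivative `∇ₖ hᵢⱼ` of a `2`-tensor. -/
def covTensor (G h : Coord n → Matrix (Fin n) (Fin n) ℝ) (k i j : Fin n) (y : Coord n) : ℝ :=
  pd k (fun z => h z i j) y
    - ∑ m, christoffel G m k i y * h y m j - ∑ m, christoffel G m k j y * h y i m

/-- The second covariant derivative `∇ₗ ∇ₖ hᵢⱼ` of a `2`-tensor. -/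
def covCovTensor (G h : Coord n → Matrix (Fin n) (Fin n) ℝ) (l k i j : Fin n)
    (y : Coord n) : ℝ :=
  pd l (covTensor G h k i j) y
    - ∑ m, christoffel G m l k y * covTensor G h m i j y
    - ∑ m, christoffel G m l i y * covTensor G h k m j y
    - ∑ m, christoffel G m l j y * covTensor G h k i m y

/-- The rough Laplacian `Δ hᵢⱼ = gᵏˡ ∇ₖ ∇ₗ hᵢⱼ`. -/
def roughLaplacian (G h : Coord n → Matrix (Fin n) (Fin n) ℝ) (i j : Fin n)
    (y : Coord n) : ℝ :=
  ∑ k, ∑ l, (G y)⁻¹ k l * covCovTensor G h k l i j y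

/-- The Riemann curvature tensor of type `(3,1)`: `R(∂ᵢ, ∂ⱼ) ∂ₖ = Rᵢⱼₖˡ ∂ₗ`, where
`R(X, Y) Z = ∇_X ∇_Y Z - ∇_Y ∇_X Z - ∇_[X,Y] Z`. -/
def riemannUp (G : Coord n → Matrix (Fin n) (Fin n) ℝ) (i j k l : Fin n) (y : Coord n) : ℝ :=
  pd i (christoffel G l j k) y - pd j (christoffel G l i k) y
    + ∑ m, christoffel G m j k y * christoffel G l i m y
    - ∑ m, christoffel G m i k y * christoffel G l j m y

/-- The Riemann curvature tensor `Rᵢⱼₖₗ = gₗₘ Rᵢⱼₖᵐ`; with this convention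
`Rᵢⱼⱼᵢ > 0` on round spheres. -/
def riemann (G : Coord n → Matrix (Fin n) (Fin n) ℝ) (i j k l : Fin n) (y : Coord n) : ℝ :=
  ∑ m, G y l m * riemannUp G i j k m y

/-- The Ricci tensor `Rⱼₖ = Rₚⱼₖᵖ = gⁱˡ Rᵢⱼₖₗ`. -/
def ricci (G : Coord n → Matrix (Fin n) (Fin n) ℝ) (j k : Fin n) (y : Coord n) : ℝ :=
  ∑ p, riemannUp G p j k p y

/-- The Lichnerowicz Laplacian
`(Δ_L h)ᵢⱼ = Δ hᵢⱼ + 2 Rₖᵢⱼₗ hₖₗ - Rᵢₖ hₖⱼ - Rⱼₖ hₖᵢ`, repeated lower indices being contracted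
with the inverse metric. -/
def lichnerowicz (G h : Coord n → Matrix (Fin n) (Fin n) ℝ) (i j : Fin n) (y : Coord n) : ℝ :=
  roughLaplacian G h i j y
    + 2 * ∑ k, ∑ l, ∑ p, ∑ q,
        (G y)⁻¹ k p * (G y)⁻¹ l q * riemann G k i j l y * h y p q
    - ∑ k, ∑ l, (G y)⁻¹ k l * ricci G i k y * h y l j
    - ∑ k, ∑ l, (G y)⁻¹ k l * ricci G j k y * h y l i

/-- DeTurck's `1`-form `Wₗ = gₗₖ gⁱʲ (Γ[g]ᵏᵢⱼ - Γ[g₀]ᵏᵢⱼ)` of the metric `G` relative to the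
background metric `G₀`. -/
def deTurckForm (G G₀ : Coord n → Matrix (Fin n) (Fin n) ℝ) (y : Coord n) (l : Fin n) : ℝ :=
  ∑ k, ∑ i, ∑ j, G y l k * (G y)⁻¹ i j * (christoffel G k i j y - christoffel G₀ k i j y)

/-! ### Tensors and metrics on manifolds -/

variable {M : Type*} [TopologicalSpace M] [ChartedSpace (Coord n) M]

variable (n M) in
/-- A covariant `2`-tensor field: a bilinear form on each tangent space. -/
abbrev TwoTensor : Type _ :=
  (x : M) → TangentSpace (𝓡 n) x →L[ℝ] TangentSpace (𝓡 n) x →L[ℝ] ℝ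

/-- The components `h(∂ᵢ, ∂ⱼ)` of a `2`-tensor in the chart `φ`, as functions of the coordinates,
where `∂ᵢ` is the image of the `i`-th standard basis vector under the differential of `φ⁻¹`. -/
def components (φ : OpenPartialHomeomorph M (Coord n)) (h : TwoTensor n M) (y : Coord n) :
    Matrix (Fin n) (Fin n) ℝ :=
  Matrix.of fun i j =>
    h (φ.symm y) (mfderiv (𝓡 n) (𝓡 n) φ.symm y (EuclideanSpace.single i 1 : Coord n))
      (mfderiv (𝓡 n) (𝓡 n) φ.symm y (EuclideanSpace.single j 1 : Coord n))

/-- A family `(h p)` of `2`-tensors, with `p` in the subset `S` of a normed space of parameters,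
is smooth if in all coordinate charts the components are jointly smooth in the parameter and the
point, up to the boundary of `S`. -/
def SmoothFamilyOn {P : Type*} [NormedAddCommGroup P] [NormedSpace ℝ P] (S : Set P)
    (h : P → TwoTensor n M) : Prop :=
  ∀ φ ∈ IsManifold.maximalAtlas (𝓡 n) ∞ M, ∀ i j : Fin n,
    ContDiffOn ℝ ∞ (fun q : P × Coord n => components φ (h q.1) q.2 i j) (S ×ˢ φ.target)

/-- The time interval `[0, T)`, where `T` may be infinite. -/
def timeInterval (T : EReal) : Set ℝ := {t | 0 ≤ t ∧ (t : EReal) < T}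

variable [IsManifold (𝓡 n) ∞ M]

variable (n M) in
/-- Smooth Riemannian metrics on `M`. -/
abbrev RMetric : Type _ :=
  Bundle.ContMDiffRiemannianMetric (𝓡 n) ∞ (Coord n) (fun x : M => TangentSpace (𝓡 n) x)

/-- The Riemannian distance of the metric `g`. -/
def metricEDist (g : RMetric n M) (x y : M) : ENNReal :=
  letI : Bundle.RiemannianBundle (fun x : M => TangentSpace (𝓡 n) x) :=
    ⟨g.toContinuousRiemannianMetric.toRiemannianMetric⟩
  Manifold.riemannianEDist (𝓡 n) x y

/-- A Riemannian metric is complete if all Cauchy sequences for its distance converge. -/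
def IsCompleteMetric (g : RMetric n M) : Prop :=
  ∀ u : ℕ → M, (∀ δ : ENNReal, 0 < δ → ∃ N, ∀ p ≥ N, ∀ q ≥ N, metricEDist g (u p) (u q) < δ) →
    ∃ x, Tendsto u atTop (𝓝 x)

/-! ### The flows -/

/-- `g` is a solution of the Ricci flow `∂ₜ gᵢⱼ = -2 Rᵢⱼ` on `M × [0, T)`. -/
structure IsRicciFlow (T : EReal) (g : ℝ → RMetric n M) : Prop where
  smooth : SmoothFamilyOn (timeInterval T) (fun t => (g t).inner)
  equation : ∀ φ ∈ IsManifold.maximalAtlas (𝓡 n) ∞ M, ∀ y ∈ φ.target, ∀ t ∈ timeInterval T,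
    ∀ i j : Fin n,
      HasDerivWithinAt (fun r => components φ (g r).inner y i j)
        (-2 * ricci (components φ (g t).inner) i j y) (timeInterval T) t

/-- `g` is a solution on `M × [0, T)` of DeTurck's modified Ricci flow
`∂ₜ gᵢⱼ = -2 Rᵢⱼ + ∇ᵢ Wⱼ + ∇ⱼ Wᵢ` with time-dependent background metrics `g₀ t`, the curvature and
the covariant derivatives being those of `g t`. -/
structure IsModifiedRicciFlow (T : EReal) (g₀ g : ℝ → RMetric n M) : Prop where
  smooth : SmoothFamilyOn (timeInterval T) (fun t => (g t).inner)
  equation : ∀ φ ∈ IsManifold.maximalAtlas (𝓡 n) ∞ M, ∀ y ∈ φ.target, ∀ t ∈ timeInterval T,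
    ∀ i j : Fin n,
      HasDerivWithinAt (fun r => components φ (g r).inner y i j)
        (-2 * ricci (components φ (g t).inner) i j y
          + covOneForm (components φ (g t).inner)
              (deTurckForm (components φ (g t).inner) (components φ (g₀ t).inner)) i j y
          + covOneForm (components φ (g t).inner)
              (deTurckForm (components φ (g t).inner) (components φ (g₀ t).inner)) j i y)
        (timeInterval T) t

/-- `h` is a solution on `M × [0, T)` of the Lichnerowicz Laplacian heat equation
`∂ₜ h = Δ_L h`: a smooth family of symmetric `2`-tensors, where `Δ_L` at time `t` is taken with
respect to the metric `g t`. -/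
structure IsLichnerowiczHeatSolution (T : EReal) (g : ℝ → RMetric n M)
    (h : ℝ → TwoTensor n M) : Prop where
  smooth : SmoothFamilyOn (timeInterval T) h
  symm : ∀ t ∈ timeInterval T, ∀ (x : M) (X Y : TangentSpace (𝓡 n) x), h t x X Y = h t x Y X
  equation : ∀ φ ∈ IsManifold.maximalAtlas (𝓡 n) ∞ M, ∀ y ∈ φ.target, ∀ t ∈ timeInterval T,
    ∀ i j : Fin n,
      HasDerivWithinAt (fun r => components φ (h r) y i j)
        (lichnerowicz (components φ (g t).inner) (components φ (h t)) i j y) (timeInterval T) t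

/-- `(g, h)` is a solution of the linearized Ricci flow system on `M × [0, T)`: `g` is a complete
solution of the Ricci flow, and `h` solves the Lichnerowicz Laplacian heat equation. -/
structure IsLinearizedRicciFlow (T : EReal) (g : ℝ → RMetric n M)
    (h : ℝ → TwoTensor n M) : Prop where
  complete : ∀ t ∈ timeInterval T, IsCompleteMetric (g t)
  ricciFlow : IsRicciFlow T g
  heat : IsLichnerowiczHeatSolution T g h

/-- The variation `v(t) = ∂/∂s|_{s=0} g_s(t)` of a one-parameter family of metrics. -/
def variation (g : ℝ → ℝ → RMetric n M) (t : ℝ) : TwoTensor n M :=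
  fun x => deriv (fun s => (g s t).inner x) 0

end LinRF

end

/-!
The linearization of the modified Ricci flow at a solution `g₀` of the Ricci flow is the
Lichnerowicz heat equation, because the DeTurck terms cancel exactly the second derivatives of the
variation `v` that spoil the Laplacian.

Everything is computed in a chart at a fixed time. By `hasVariation_christoffel` the Christoffel
symbols vary by `Aᵖⱼₖ = ½ gᵖˡ (∇ⱼ vₖₗ + ∇ₖ vⱼₗ - ∇ₗ vⱼₖ)`, obtained by differentiating in `s` the
formula for the symbols of the first kind. Hence the Ricci tensor varies by `∇ₚ Aᵖⱼₖ - ∇ⱼ Aᵖₚₖ`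
(`IsMetricOn.varRicci_eq`). Since the DeTurck form vanishes at `s = 0`, only the connection in it
contributes to first order: it varies by `∇ᵖ vₚₗ - ½ ∇ₗ tr v`
(`IsMetricOn.varDeTurckForm_eq`), and `∇ W` varies by the covariant derivative of this form with
respect to `g₀`. In `-2 δRᵢⱼ + ∇ᵢ δWⱼ + ∇ⱼ δWᵢ` all second derivatives other than `Δ v` combine to
commutators of covariant derivatives, which the Ricci identity
`IsMetricOn.covCovTensor_sub_comm` and the symmetries of the curvature turn into the
zeroth-order terms of `Δ_L`: this is `IsMetricOn.varRicci_add_covOneForm_eq_lichnerowicz`. The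
symmetries themselves come cheaply: antisymmetry in the last pair of indices is the Ricci identity
for the parallel tensor `g₀`.

It remains to exchange `∂ₜ` and `∂ₛ`. The domain of the family need not be a product, but near
`s = 0` and a given time it contains a box `(-δ, δ) × [0, t₁)` (`exists_box`), on which second
derivatives are symmetric up to the boundary `t = 0` (`hasDerivWithinAt_deriv_comm`).
-/

noncomputable section

namespace LinRF

/-! ### Partial derivatives and first variations of families of functions -/

section

variable {n : ℕ}

lemma two_le_infty : (2 : ℕ∞ω) ≤ ∞ :=
  WithTop.coe_le_coe.mpr (le_top : (2 : ℕ∞) ≤ ⊤)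

/-- The derivative of a directional derivative along a map is given by the second derivative. -/
lemma hasFDerivAt_fderiv_apply {D E : Type*} [NormedAddCommGroup D] [NormedSpace ℝ D]
    [NormedAddCommGroup E] [NormedSpace ℝ E] {F : E → ℝ} {c : D → E} {c' : D →L[ℝ] E} {x : D}
    (hd : DifferentiableAt ℝ (fderiv ℝ F) (c x)) (hc : HasFDerivAt c c' x) (e : E) :
    HasFDerivAt (fun w => fderiv ℝ F (c w) e)
      ((ContinuousLinearMap.apply ℝ ℝ e).comp ((fderiv ℝ (fderiv ℝ F) (c x)).comp c')) x :=
  (ContinuousLinearMap.apply ℝ ℝ e).hasFDerivAt.comp x (hd.hasFDerivAt.comp x hc)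

lemma pd_add {f g : Coord n → ℝ} {y : Coord n} (k : Fin n) (hf : DifferentiableAt ℝ f y)
    (hg : DifferentiableAt ℝ g y) : pd k (fun z => f z + g z) y = pd k f y + pd k g y := by
  simp [pd, fderiv_fun_add hf hg]

lemma pd_sub {f g : Coord n → ℝ} {y : Coord n} (k : Fin n) (hf : DifferentiableAt ℝ f y)
    (hg : DifferentiableAt ℝ g y) : pd k (fun z => f z - g z) y = pd k f y - pd k g y := by
  simp [pd, fderiv_fun_sub hf hg]

lemma pd_mul {f g : Coord n → ℝ} {y : Coord n} (k : Fin n) (hf : DifferentiableAt ℝ f y)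
    (hg : DifferentiableAt ℝ g y) :
    pd k (fun z => f z * g z) y = pd k f y * g y + f y * pd k g y := by
  simp [pd, fderiv_fun_mul hf hg]; ring

lemma pd_const_mul {f : Coord n → ℝ} {y : Coord n} (k : Fin n) (c : ℝ)
    (hf : DifferentiableAt ℝ f y) : pd k (fun z => c * f z) y = c * pd k f y := by
  simp [pd, fderiv_const_mul hf]

lemma pd_sum {ι : Type*} {u : Finset ι} {f : ι → Coord n → ℝ} {y : Coord n} (k : Fin n)
    (hf : ∀ i ∈ u, DifferentiableAt ℝ (f i) y) :
    pd k (fun z => ∑ i ∈ u, f i z) y = ∑ i ∈ u, pd k (f i) y := by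
  simp [pd, fderiv_fun_sum hf]

lemma pd_congr {f g : Coord n → ℝ} {y : Coord n} (k : Fin n) (h : f =ᶠ[𝓝 y] g) :
    pd k f y = pd k g y := by
  simp [pd, h.fderiv_eq]

lemma contDiffAt_pd {f : Coord n → ℝ} {y : Coord n} (k : Fin n) (hf : ContDiffAt ℝ ∞ f y) :
    ContDiffAt ℝ ∞ (pd k f) y :=
  (hf.fderiv_right (m := ∞) (by simp)).clm_apply contDiffAt_const

lemma pd_comm {f : Coord n → ℝ} {y : Coord n} (k l : Fin n) (hf : ContDiffAt ℝ ∞ f y) :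
    pd k (pd l f) y = pd l (pd k f) y := by
  have hd : DifferentiableAt ℝ (fderiv ℝ f) y :=
    (hf.fderiv_right (m := ∞) (by simp)).differentiableAt (by simp)
  have h : ∀ a b : Fin n, pd a (pd b f) y =
      fderiv ℝ (fderiv ℝ f) y (EuclideanSpace.single a 1) (EuclideanSpace.single b 1) := by
    intro a b
    change fderiv ℝ (fun z => fderiv ℝ f z (EuclideanSpace.single b 1)) y _ = _
    rw [fderiv_clm_apply hd (by fun_prop)]
    simp
  rw [h, h]
  exact (hf.isSymmSndFDerivAt (by simpa using two_le_infty)).eq _ _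

/-- `f s` is a family of functions on the open set `Ω`, jointly smooth in the parameter and the
point near `s = 0`, and its variation `∂/∂s|_{s=0} f s` is `f'`. -/
structure HasVariation (Ω : Set (Coord n)) (f : ℝ → Coord n → ℝ) (f' : Coord n → ℝ) : Prop where
  smooth : ∀ z ∈ Ω, ContDiffAt ℝ ∞ (fun q : ℝ × Coord n => f q.1 q.2) (0, z)
  deriv : ∀ z ∈ Ω, HasDerivAt (fun s => f s z) (f' z) 0

namespace HasVariation

variable {Ω : Set (Coord n)} {f g : ℝ → Coord n → ℝ} {f' g' : Coord n → ℝ}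

lemma of_contDiffAt
    (h : ∀ z ∈ Ω, ContDiffAt ℝ ∞ (fun q : ℝ × Coord n => f q.1 q.2) (0, z)) :
    HasVariation Ω f (fun z => _root_.deriv (fun s => f s z) 0) where
  smooth := h
  deriv z hz := by
    have h1 : DifferentiableAt ℝ (fun s : ℝ => f s z) 0 := by
      have := (h z hz).differentiableAt (by simp)
      exact this.comp (0 : ℝ) (f := fun s : ℝ => (s, z)) (by fun_prop)
    exact h1.hasDerivAt

lemma const (h : ∀ z ∈ Ω, ContDiffAt ℝ ∞ f' z) : HasVariation Ω (fun _ => f') 0 where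
  smooth z hz := (h z hz).comp ((0 : ℝ), z) (f := fun q : ℝ × Coord n => q.2) contDiffAt_snd
  deriv z _ := by simpa using hasDerivAt_const (0 : ℝ) (f' z)

lemma congr_right (h : HasVariation Ω f f') (h' : ∀ z ∈ Ω, f' z = g' z) :
    HasVariation Ω f g' where
  smooth := h.smooth
  deriv z hz := h' z hz ▸ h.deriv z hz

lemma add (hf : HasVariation Ω f f') (hg : HasVariation Ω g g') :
    HasVariation Ω (fun s z => f s z + g s z) (fun z => f' z + g' z) where
  smooth z hz := (hf.smooth z hz).add (hg.smooth z hz)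
  deriv z hz := (hf.deriv z hz).add (hg.deriv z hz)

lemma sub (hf : HasVariation Ω f f') (hg : HasVariation Ω g g') :
    HasVariation Ω (fun s z => f s z - g s z) (fun z => f' z - g' z) where
  smooth z hz := (hf.smooth z hz).sub (hg.smooth z hz)
  deriv z hz := (hf.deriv z hz).sub (hg.deriv z hz)

lemma mul (hf : HasVariation Ω f f') (hg : HasVariation Ω g g') :
    HasVariation Ω (fun s z => f s z * g s z) (fun z => f' z * g 0 z + f 0 z * g' z) where
  smooth z hz := (hf.smooth z hz).mul (hg.smooth z hz)
  deriv z hz := (hf.deriv z hz).mul (hg.deriv z hz)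

lemma const_mul (c : ℝ) (hf : HasVariation Ω f f') :
    HasVariation Ω (fun s z => c * f s z) (fun z => c * f' z) where
  smooth z hz := contDiffAt_const.mul (hf.smooth z hz)
  deriv z hz := (hf.deriv z hz).const_mul c

lemma sum {ι : Type*} {u : Finset ι} {f : ι → ℝ → Coord n → ℝ} {f' : ι → Coord n → ℝ}
    (h : ∀ i ∈ u, HasVariation Ω (f i) (f' i)) :
    HasVariation Ω (fun s z => ∑ i ∈ u, f i s z) (fun z => ∑ i ∈ u, f' i z) where
  smooth z hz := ContDiffAt.sum fun i hi => (h i hi).smooth z hz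
  deriv z hz := HasDerivAt.fun_sum fun i hi => (h i hi).deriv z hz

/-- The variation is the derivative of the joint function in the direction of the parameter. -/
lemma eq_fderiv (hf : HasVariation Ω f f') {z : Coord n} (hz : z ∈ Ω) :
    f' z = fderiv ℝ (fun q : ℝ × Coord n => f q.1 q.2) (0, z) (1, 0) := by
  have h1 := ((hf.smooth z hz).differentiableAt (by simp)).hasFDerivAt
  have h2 : HasDerivAt (fun s : ℝ => (s, z)) ((1 : ℝ), (0 : Coord n)) 0 :=
    (hasDerivAt_id _).prodMk (hasDerivAt_const _ _)
  exact (hf.deriv z hz).unique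
    (h1.comp_hasDerivAt_of_eq (f := fun s : ℝ => (s, z)) (0 : ℝ) h2 rfl)

lemma contDiffAt_fderiv (hf : HasVariation Ω f f') {z : Coord n} (hz : z ∈ Ω) :
    ContDiffAt ℝ ∞ (fderiv ℝ (fun q : ℝ × Coord n => f q.1 q.2)) (0, z) :=
  (hf.smooth z hz).fderiv_right (m := ∞) (by simp)

lemma contDiffAt (hΩ : IsOpen Ω) (hf : HasVariation Ω f f') {z : Coord n} (hz : z ∈ Ω) :
    ContDiffAt ℝ ∞ f' z := by
  have h : ContDiffAt ℝ ∞
      (fun w => fderiv ℝ (fun q : ℝ × Coord n => f q.1 q.2) (0, w) (1, 0)) z :=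
    ((hf.contDiffAt_fderiv hz).comp z (f := fun w => ((0 : ℝ), w)) (by fun_prop)).clm_apply
      contDiffAt_const
  refine h.congr_of_eventuallyEq ?_
  filter_upwards [hΩ.mem_nhds hz] with w hw using hf.eq_fderiv hw

/-- The variation of a spatial partial derivative is the partial derivative of the variation: both
are second derivatives of the joint function, which are symmetric. -/
lemma pd (hΩ : IsOpen Ω) (k : Fin n) (hf : HasVariation Ω f f') :
    HasVariation Ω (fun s => pd k (f s)) (LinRF.pd k f') := by
  set F : ℝ × Coord n → ℝ := fun q => f q.1 q.2 with hF
  set e : Coord n := EuclideanSpace.single k 1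
  -- near each point the spatial derivative is a directional derivative of the joint function
  have key : ∀ z ∈ Ω, ∀ᶠ q : ℝ × Coord n in 𝓝 (0, z),
      LinRF.pd k (f q.1) q.2 = fderiv ℝ F q (0, e) := by
    intro z hz
    have h1 : ∀ᶠ q in 𝓝 ((0 : ℝ), z), ContDiffAt ℝ 1 F q :=
      ((hf.smooth z hz).of_le (by exact_mod_cast le_top)).eventually (by simp)
    filter_upwards [h1] with q hq
    have h2 : HasFDerivAt (fun w : Coord n => (q.1, w))
        (ContinuousLinearMap.inr ℝ ℝ (Coord n)) q.2 := hasFDerivAt_prodMk_right _ _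
    have h3 : HasFDerivAt (f q.1)
        ((fderiv ℝ F q).comp (ContinuousLinearMap.inr ℝ ℝ (Coord n))) q.2 :=
      HasFDerivAt.comp (g := F) (f := fun w : Coord n => (q.1, w)) q.2
        ((hq.differentiableAt (by simp)).hasFDerivAt) h2
    change fderiv ℝ (f q.1) q.2 e = _
    rw [h3.fderiv]
    simp
  refine ⟨fun z hz => ?_, fun z hz => ?_⟩
  · refine ContDiffAt.congr_of_eventuallyEq ?_ (key z hz)
    exact (hf.contDiffAt_fderiv hz).clm_apply contDiffAt_const
  · have hd : DifferentiableAt ℝ (fderiv ℝ F) (0, z) :=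
      (hf.contDiffAt_fderiv hz).differentiableAt (by simp)
    have h2 : HasFDerivAt (fun s : ℝ => (s, z)) (ContinuousLinearMap.inl ℝ ℝ (Coord n)) 0 :=
      hasFDerivAt_prodMk_left _ _
    have h4 : HasDerivAt (fun s : ℝ => fderiv ℝ F (s, z) (0, e))
        (fderiv ℝ (fderiv ℝ F) (0, z) (1, 0) (0, e)) 0 := by
      have := (hasFDerivAt_fderiv_apply (c := fun s : ℝ => (s, z)) hd h2 ((0 : ℝ), e)).hasDerivAt
      simpa using this
    have h5 : LinRF.pd k f' z = fderiv ℝ (fderiv ℝ F) (0, z) (1, 0) (0, e) := by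
      rw [((hf.smooth z hz).isSymmSndFDerivAt (by simpa using two_le_infty)).eq]
      have h6 : f' =ᶠ[𝓝 z] fun w => fderiv ℝ F (0, w) (1, 0) := by
        filter_upwards [hΩ.mem_nhds hz] with w hw using hf.eq_fderiv hw
      rw [pd_congr k h6]
      have h7 : HasFDerivAt (fun w : Coord n => ((0 : ℝ), w))
        (ContinuousLinearMap.inr ℝ ℝ (Coord n)) z := hasFDerivAt_prodMk_right _ _
      have h8 := (hasFDerivAt_fderiv_apply hd h7 ((1 : ℝ), (0 : Coord n))).fderiv
      change fderiv ℝ (fun w => fderiv ℝ F (0, w) (1, 0)) z e = _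
      rw [h8]
      simp [hF]
    rw [h5]
    refine h4.congr_of_eventuallyEq ?_
    have hc : Tendsto (fun s : ℝ => (s, z)) (𝓝 0) (𝓝 (0, z)) :=
      Continuous.tendsto' (by fun_prop) _ _ rfl
    exact hc.eventually (key z hz)

end HasVariation

end

/-! ### The Levi-Civita connection in local coordinates -/

section

lemma contDiffAt_det {X : Type*} [NormedAddCommGroup X] [NormedSpace ℝ X] {n : ℕ}
    {A : X → Matrix (Fin n) (Fin n) ℝ} {x : X}
    (hA : ∀ i j, ContDiffAt ℝ ∞ (fun z => A z i j) x) :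
    ContDiffAt ℝ ∞ (fun z => (A z).det) x := by
  simp only [Matrix.det_apply']
  exact ContDiffAt.sum fun σ _ => contDiffAt_const.mul (contDiffAt_prod fun i _ => hA _ _)

lemma contDiffAt_inv_apply {X : Type*} [NormedAddCommGroup X] [NormedSpace ℝ X] {n : ℕ}
    {A : X → Matrix (Fin n) (Fin n) ℝ} {x : X}
    (hA : ∀ i j, ContDiffAt ℝ ∞ (fun z => A z i j) x) (hx : IsUnit (A x).det) (i j : Fin n) :
    ContDiffAt ℝ ∞ (fun z => (A z)⁻¹ i j) x := by
  simp only [Matrix.inv_def, Matrix.smul_apply, smul_eq_mul, Matrix.adjugate_apply,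
    Ring.inverse_eq_inv']
  refine ((contDiffAt_det hA).inv hx.ne_zero).mul (contDiffAt_det fun a b => ?_)
  by_cases h : a = j
  · subst h
    simp only [Matrix.updateRow_self]
    exact contDiffAt_const
  · simp only [Matrix.updateRow_ne h]
    exact hA a b

variable {n : ℕ}

/-- `G` is a metric in local coordinates on the open set `Ω`: a smooth field of symmetric
invertible matrices. Positivity plays no role in the tensor calculus. -/
structure IsMetricOn (Ω : Set (Coord n)) (G : Coord n → Matrix (Fin n) (Fin n) ℝ) : Prop where
  isOpen : IsOpen Ω
  smooth : ∀ i j, ∀ z ∈ Ω, ContDiffAt ℝ ∞ (fun z => G z i j) z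
  symm : ∀ z ∈ Ω, ∀ i j, G z i j = G z j i
  unit : ∀ z ∈ Ω, IsUnit (G z).det

lemma pd_congr_on {Ω : Set (Coord n)} (hΩ : IsOpen Ω) {f g : Coord n → ℝ}
    (h : ∀ z ∈ Ω, f z = g z) {z : Coord n} (hz : z ∈ Ω) (k : Fin n) : pd k f z = pd k g z :=
  pd_congr k (by filter_upwards [hΩ.mem_nhds hz] with w hw using h w hw)

namespace IsMetricOn

variable {Ω : Set (Coord n)} {G : Coord n → Matrix (Fin n) (Fin n) ℝ} {z : Coord n}

lemma inv_symm (hG : IsMetricOn Ω G) (hz : z ∈ Ω) (i j : Fin n) :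
    (G z)⁻¹ i j = (G z)⁻¹ j i := by
  have h : (G z).transpose = G z := by
    ext a b
    exact hG.symm z hz b a
  have h2 := Matrix.transpose_nonsing_inv (G z)
  rw [h] at h2
  exact congrFun (congrFun h2 j) i

lemma contDiffAt_inv (hG : IsMetricOn Ω G) (hz : z ∈ Ω) (i j : Fin n) :
    ContDiffAt ℝ ∞ (fun w => (G w)⁻¹ i j) z :=
  contDiffAt_inv_apply (fun a b => hG.smooth a b z hz) (hG.unit z hz) i j

lemma contDiffAt_christoffel (hG : IsMetricOn Ω G) (hz : z ∈ Ω) (k i j : Fin n) :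
    ContDiffAt ℝ ∞ (christoffel G k i j) z := by
  refine contDiffAt_const.mul (ContDiffAt.sum fun l _ => (hG.contDiffAt_inv hz k l).mul ?_)
  exact ((contDiffAt_pd i (hG.smooth j l z hz)).add (contDiffAt_pd j (hG.smooth i l z hz))).sub
    (contDiffAt_pd l (hG.smooth i j z hz))

lemma christoffel_symm (hG : IsMetricOn Ω G) (hz : z ∈ Ω) (k i j : Fin n) :
    christoffel G k i j z = christoffel G k j i z := by
  simp only [christoffel]
  congr 1
  refine Finset.sum_congr rfl fun l _ => ?_
  rw [pd_congr_on hG.isOpen (fun w hw => hG.symm w hw i j) hz l]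
  ring

lemma sum_mul_inv_mul (hG : IsMetricOn Ω G) (hz : z ∈ Ω) (c : Fin n → ℝ) (k : Fin n) :
    ∑ m, G z k m * ∑ l, (G z)⁻¹ m l * c l = c k := by
  have h : (G z).mulVec ((G z)⁻¹.mulVec c) = c := by
    rw [Matrix.mulVec_mulVec, Matrix.mul_nonsing_inv _ (hG.unit z hz), Matrix.one_mulVec]
  exact congrFun h k

lemma sum_inv_mul_mul (hG : IsMetricOn Ω G) (hz : z ∈ Ω) (c : Fin n → ℝ) (k : Fin n) :
    ∑ m, (G z)⁻¹ k m * ∑ l, G z m l * c l = c k := by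
  have h : (G z)⁻¹.mulVec ((G z).mulVec c) = c := by
    rw [Matrix.mulVec_mulVec, Matrix.nonsing_inv_mul _ (hG.unit z hz), Matrix.one_mulVec]
  exact congrFun h k

/-- The Christoffel symbols of the first kind. -/
lemma sum_mul_christoffel (hG : IsMetricOn Ω G) (hz : z ∈ Ω) (k i j : Fin n) :
    ∑ m, G z k m * christoffel G m i j z =
      1 / 2 * (pd i (fun w => G w j k) z + pd j (fun w => G w i k) z
        - pd k (fun w => G w i j) z) := by
  rw [← hG.sum_mul_inv_mul hz (fun l => 1 / 2 * (pd i (fun w => G w j l) z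
    + pd j (fun w => G w i l) z - pd l (fun w => G w i j) z)) k]
  refine Finset.sum_congr rfl fun m _ => ?_
  simp only [christoffel, Finset.mul_sum]
  exact Finset.sum_congr rfl fun l _ => by ring

/-- The Levi-Civita connection is compatible with the metric. -/
lemma covTensor_self (hG : IsMetricOn Ω G) (hz : z ∈ Ω) (k i j : Fin n) :
    covTensor G G k i j z = 0 := by
  have h1 := hG.sum_mul_christoffel hz i k j
  have h2 := hG.sum_mul_christoffel hz j k i
  have h3 : ∑ m, christoffel G m k i z * G z m j = ∑ m, G z j m * christoffel G m k i z :=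
    Finset.sum_congr rfl fun m _ => by rw [hG.symm z hz m j]; ring
  have h4 : ∑ m, christoffel G m k j z * G z i m = ∑ m, G z i m * christoffel G m k j z :=
    Finset.sum_congr rfl fun m _ => by ring
  have h5 := pd_congr_on hG.isOpen (fun w hw => hG.symm w hw i j) hz k
  have h6 := pd_congr_on hG.isOpen (fun w hw => hG.symm w hw k j) hz i
  have h7 := pd_congr_on hG.isOpen (fun w hw => hG.symm w hw k i) hz j
  rw [covTensor, h3, h4, h1, h2]
  linarith

/-- The inverse metric is parallel. -/
lemma pd_inv (hG : IsMetricOn Ω G) (hz : z ∈ Ω) (i a b : Fin n) :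
    pd i (fun w => (G w)⁻¹ a b) z =
      - ∑ m, christoffel G a i m z * (G z)⁻¹ m b - ∑ m, christoffel G b i m z * (G z)⁻¹ a m := by
  set P : Matrix (Fin n) (Fin n) ℝ := Matrix.of fun a b => pd i (fun w => G w a b) z with hP
  set Q : Matrix (Fin n) (Fin n) ℝ := Matrix.of fun a b => pd i (fun w => (G w)⁻¹ a b) z with hQ
  set C : Matrix (Fin n) (Fin n) ℝ := Matrix.of fun m a => christoffel G m i a z with hC
  -- metric compatibility, and the derivative of `G⁻¹ G = 1`, in matrix form
  have h1 : P = C.transpose * G z + G z * C := by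
    ext c d
    have := hG.covTensor_self hz i c d
    rw [covTensor] at this
    simp only [hP, hC, Matrix.of_apply, Matrix.add_apply, Matrix.mul_apply,
      Matrix.transpose_apply]
    have h4 : ∑ m, christoffel G m i d z * G z c m = ∑ m, G z c m * christoffel G m i d z :=
      Finset.sum_congr rfl fun m _ => by ring
    linarith
  have h2 : Q * G z + (G z)⁻¹ * P = 0 := by
    ext c d
    have h3 : pd i (fun w => ∑ m, (G w)⁻¹ c m * G w m d) z = 0 := by
      rw [pd_congr_on hG.isOpen (g := fun _ => (1 : Matrix (Fin n) (Fin n) ℝ) c d) _ hz]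
      · simp [pd]
      · intro w hw
        rw [← Matrix.mul_apply, Matrix.nonsing_inv_mul _ (hG.unit w hw)]
    rw [pd_sum] at h3
    · simp only [Matrix.add_apply, Matrix.mul_apply, ← Finset.sum_add_distrib, Matrix.zero_apply]
      rw [← h3]
      refine Finset.sum_congr rfl fun m _ => ?_
      rw [pd_mul i ((hG.contDiffAt_inv hz c m).differentiableAt (by simp))
        ((hG.smooth m d z hz).differentiableAt (by simp))]
      rfl
    · intro m _
      exact ((hG.contDiffAt_inv hz c m).mul (hG.smooth m d z hz)).differentiableAt (by simp)
  have h5 : Q = - (C * (G z)⁻¹) - (G z)⁻¹ * C.transpose := by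
    have e1 : G z * (G z)⁻¹ = 1 := Matrix.mul_nonsing_inv _ (hG.unit z hz)
    have e2 : (G z)⁻¹ * G z = 1 := Matrix.nonsing_inv_mul _ (hG.unit z hz)
    calc Q = (Q * G z) * (G z)⁻¹ := by rw [Matrix.mul_assoc, e1, Matrix.mul_one]
      _ = - ((G z)⁻¹ * P * (G z)⁻¹) := by
        rw [eq_neg_of_add_eq_zero_left h2, Matrix.neg_mul]
      _ = - ((G z)⁻¹ * C.transpose * (G z * (G z)⁻¹) + ((G z)⁻¹ * G z) * C * (G z)⁻¹) := by
        rw [h1]; noncomm_ring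
      _ = _ := by rw [e1, e2]; noncomm_ring
  have h6 := congrFun (congrFun h5 a) b
  simp only [hQ, hC, Matrix.of_apply, Matrix.sub_apply, Matrix.neg_apply, Matrix.mul_apply,
    Matrix.transpose_apply] at h6
  rw [h6]
  congr 1
  exact Finset.sum_congr rfl fun m _ => by ring

/-- Raising an index commutes with covariant differentiation. -/
lemma pd_sum_inv_mul (hG : IsMetricOn Ω G) (hz : z ∈ Ω) (i p : Fin n) {a : Fin n → Coord n → ℝ}
    (ha : ∀ l, DifferentiableAt ℝ (a l) z) :
    pd i (fun w => ∑ l, (G w)⁻¹ p l * a l w) z =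
      ∑ l, (G z)⁻¹ p l * (pd i (a l) z - ∑ m, christoffel G m i l z * a m z)
        - ∑ m, christoffel G p i m z * ∑ l, (G z)⁻¹ m l * a l z := by
  have hJ := fun l => (hG.contDiffAt_inv hz p l).differentiableAt (by simp)
  rw [pd_sum _ fun l _ => (hJ l).fun_mul (ha l)]
  have e : ∀ l, pd i (fun w => (G w)⁻¹ p l * a l w) z =
      - (∑ m, christoffel G p i m z * (G z)⁻¹ m l * a l z)
      - (∑ m, christoffel G l i m z * (G z)⁻¹ p m * a l z) + (G z)⁻¹ p l * pd i (a l) z := by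
    intro l
    rw [pd_mul i (hJ l) (ha l), hG.pd_inv hz, sub_mul, neg_mul, Finset.sum_mul, Finset.sum_mul]
  simp only [e, Finset.sum_add_distrib, Finset.sum_sub_distrib, Finset.sum_neg_distrib, mul_sub,
    Finset.mul_sum]
  rw [Finset.sum_comm (f := fun l m => christoffel G p i m z * (G z)⁻¹ m l * a l z),
    Finset.sum_comm (f := fun l m => christoffel G l i m z * (G z)⁻¹ p m * a l z)]
  simp only [mul_assoc, mul_left_comm]
  ring

/-- The metric contraction of a pair of indices commutes with covariant differentiation. -/
lemma pd_sum_sum_inv_mul (hG : IsMetricOn Ω G) (hz : z ∈ Ω) (i : Fin n)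
    {t : Fin n → Fin n → Coord n → ℝ} (ht : ∀ p l, DifferentiableAt ℝ (t p l) z) :
    pd i (fun w => ∑ p, ∑ l, (G w)⁻¹ p l * t p l w) z =
      ∑ p, ∑ l, (G z)⁻¹ p l * (pd i (t p l) z - ∑ m, christoffel G m i p z * t m l z
        - ∑ m, christoffel G m i l z * t p m z) := by
  have hJ := fun p l => (hG.contDiffAt_inv hz p l).differentiableAt (by simp)
  rw [pd_sum _ fun p _ => DifferentiableAt.fun_sum fun l _ => (hJ p l).fun_mul (ht p l)]
  simp only [hG.pd_sum_inv_mul hz i _ (ht _), mul_sub, Finset.sum_sub_distrib, Finset.mul_sum]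
  have e : ∑ p, ∑ m, ∑ l, christoffel G p i m z * ((G z)⁻¹ m l * t p l z) =
      ∑ p, ∑ l, ∑ m, (G z)⁻¹ p l * (christoffel G m i p z * t m l z) := by
    rw [Finset.sum_comm]
    refine Finset.sum_congr rfl fun p _ => ?_
    rw [Finset.sum_comm]
    exact Finset.sum_congr rfl fun l _ => Finset.sum_congr rfl fun m _ => by ring
  rw [e]
  ring

end IsMetricOn

end

/-! ### The Ricci identity and the symmetries of the curvature -/

section

variable {n : ℕ}

namespace IsMetricOn

variable {Ω : Set (Coord n)} {G h : Coord n → Matrix (Fin n) (Fin n) ℝ} {z : Coord n}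

lemma contDiffAt_covTensor (hG : IsMetricOn Ω G)
    (hh : ∀ i j, ∀ z ∈ Ω, ContDiffAt ℝ ∞ (fun w => h w i j) z) (hz : z ∈ Ω) (k i j : Fin n) :
    ContDiffAt ℝ ∞ (covTensor G h k i j) z :=
  ((contDiffAt_pd k (hh i j z hz)).sub (ContDiffAt.sum fun m _ =>
    (hG.contDiffAt_christoffel hz m k i).mul (hh m j z hz))).sub (ContDiffAt.sum fun m _ =>
      (hG.contDiffAt_christoffel hz m k j).mul (hh i m z hz))

lemma pd_christoffel_mul (hG : IsMetricOn Ω G) {f : Fin n → Coord n → ℝ}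
    (hf : ∀ m, ContDiffAt ℝ ∞ (f m) z) (hz : z ∈ Ω) (a b c : Fin n) :
    pd a (fun w => ∑ m, christoffel G m b c w * f m w) z =
      ∑ m, pd a (christoffel G m b c) z * f m z + ∑ m, christoffel G m b c z * pd a (f m) z := by
  have h1 := fun m => (hG.contDiffAt_christoffel hz m b c).differentiableAt (by simp)
  have h2 := fun m => (hf m).differentiableAt (by simp)
  rw [pd_sum _ fun m _ => (h1 m).fun_mul (h2 m), ← Finset.sum_add_distrib]
  exact Finset.sum_congr rfl fun m _ => pd_mul a (h1 m) (h2 m)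

lemma pd_covTensor (hG : IsMetricOn Ω G)
    (hh : ∀ i j, ∀ z ∈ Ω, ContDiffAt ℝ ∞ (fun w => h w i j) z) (hz : z ∈ Ω) (a b c d : Fin n) :
    pd a (covTensor G h b c d) z =
      pd a (pd b fun w => h w c d) z
        - (∑ m, pd a (christoffel G m b c) z * h z m d
          + ∑ m, christoffel G m b c z * pd a (fun w => h w m d) z)
        - (∑ m, pd a (christoffel G m b d) z * h z c m
          + ∑ m, christoffel G m b d z * pd a (fun w => h w c m) z) := by
  have h0 := (contDiffAt_pd b (hh c d z hz)).differentiableAt (by simp)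
  have h1 : DifferentiableAt ℝ (fun w => ∑ m, christoffel G m b c w * h w m d) z :=
    (ContDiffAt.sum fun m _ =>
      (hG.contDiffAt_christoffel hz m b c).mul (hh m d z hz)).differentiableAt (by simp)
  have h2 : DifferentiableAt ℝ (fun w => ∑ m, christoffel G m b d w * h w c m) z :=
    (ContDiffAt.sum fun m _ =>
      (hG.contDiffAt_christoffel hz m b d).mul (hh c m z hz)).differentiableAt (by simp)
  rw [← hG.pd_christoffel_mul (fun m => hh m d z hz) hz,
    ← hG.pd_christoffel_mul (fun m => hh c m z hz) hz, ← pd_sub _ h0 h1,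
    ← pd_sub _ (h0.fun_sub h1) h2]
  rfl

/-- The Ricci identity: second covariant derivatives of a `2`-tensor commute up to curvature. -/
lemma covCovTensor_sub_comm (hG : IsMetricOn Ω G)
    (hh : ∀ i j, ∀ z ∈ Ω, ContDiffAt ℝ ∞ (fun w => h w i j) z) (hz : z ∈ Ω) (a b c d : Fin n) :
    covCovTensor G h a b c d z - covCovTensor G h b a c d z =
      - ∑ m, riemannUp G a b c m z * h z m d - ∑ m, riemannUp G a b d m z * h z c m := by
  -- all objects are matrices in the last two indices
  let Γ : Fin n → Matrix (Fin n) (Fin n) ℝ := fun a => .of fun m c => christoffel G m a c z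
  let dΓ : Fin n → Fin n → Matrix (Fin n) (Fin n) ℝ :=
    fun a b => .of fun m c => pd a (christoffel G m b c) z
  let dh : Fin n → Matrix (Fin n) (Fin n) ℝ := fun a => .of fun c d => pd a (fun w => h w c d) z
  let ddh : Fin n → Fin n → Matrix (Fin n) (Fin n) ℝ :=
    fun a b => .of fun c d => pd a (pd b fun w => h w c d) z
  let D : Fin n → Matrix (Fin n) (Fin n) ℝ := fun b => .of fun c d => covTensor G h b c d z
  let R : Matrix (Fin n) (Fin n) ℝ := .of fun m c => riemannUp G a b c m z
  have hD : ∀ b, D b = dh b - (Γ b).transpose * h z - h z * Γ b := by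
    intro b
    ext c d
    simp [D, dh, Γ, Matrix.mul_apply, covTensor, mul_comm (h z c _)]
  have hDD : ∀ a b c d, covCovTensor G h a b c d z = (ddh a b
      - ((dΓ a b).transpose * h z + (Γ b).transpose * dh a) - (h z * dΓ a b + dh a * Γ b)
      - (Γ a).transpose * D b - D b * Γ a) c d
      - ∑ m, christoffel G m a b z * covTensor G h m c d z := by
    intro a b c d
    rw [covCovTensor, hG.pd_covTensor hh hz]
    simp only [D, dh, ddh, dΓ, Γ, Matrix.sub_apply, Matrix.add_apply, Matrix.mul_apply,
      Matrix.of_apply, Matrix.transpose_apply, mul_comm (h z c _),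
      mul_comm (pd a (fun w => h w c _) z), mul_comm (covTensor G h b c _ z)]
    ring
  have hR : R = dΓ a b - dΓ b a + Γ a * Γ b - Γ b * Γ a := by
    ext m c
    simp only [R, dΓ, Γ, riemannUp, Matrix.sub_apply, Matrix.add_apply, Matrix.mul_apply,
      Matrix.of_apply, mul_comm (christoffel G m _ _ z)]
  have hs : ∑ m, christoffel G m a b z * covTensor G h m c d z =
      ∑ m, christoffel G m b a z * covTensor G h m c d z :=
    Finset.sum_congr rfl fun m _ => by rw [hG.christoffel_symm hz]
  have hdd : ddh a b = ddh b a := by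
    ext c d
    exact pd_comm a b (hh c d z hz)
  have hRR : - ∑ m, riemannUp G a b c m z * h z m d - ∑ m, riemannUp G a b d m z * h z c m =
      (- (R.transpose * h z) - h z * R) c d := by
    simp [R, Matrix.mul_apply, mul_comm (h z c _)]
  rw [hRR, hDD, hDD, hs, sub_sub_sub_cancel_right, ← Matrix.sub_apply]
  refine congrFun (congrFun ?_ c) d
  rw [hD, hD, hR, hdd]
  simp only [Matrix.transpose_sub, Matrix.transpose_add, Matrix.transpose_mul]
  noncomm_ring

lemma riemannUp_antisymm_left (a b c l : Fin n) :
    riemannUp G a b c l z = - riemannUp G b a c l z := by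
  simp only [riemannUp]
  ring

lemma riemann_antisymm_left (a b c d : Fin n) :
    riemann G a b c d z = - riemann G b a c d z := by
  simp only [riemann, ← Finset.sum_neg_distrib]
  exact Finset.sum_congr rfl fun m _ => by rw [riemannUp_antisymm_left]; ring

/-- The first Bianchi identity. -/
lemma riemannUp_bianchi (hG : IsMetricOn Ω G) (hz : z ∈ Ω) (a b c l : Fin n) :
    riemannUp G a b c l z + riemannUp G b c a l z + riemannUp G c a b l z = 0 := by
  have h1 := pd_congr_on hG.isOpen (fun w hw => hG.christoffel_symm hw l b c) hz a
  have h2 := pd_congr_on hG.isOpen (fun w hw => hG.christoffel_symm hw l c a) hz b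
  have h3 := pd_congr_on hG.isOpen (fun w hw => hG.christoffel_symm hw l a b) hz c
  have h4 : ∀ a b c : Fin n, ∑ m, christoffel G m a b z * christoffel G l c m z =
      ∑ m, christoffel G m b a z * christoffel G l c m z := fun a b c =>
    Finset.sum_congr rfl fun m _ => by rw [hG.christoffel_symm hz m]
  simp only [riemannUp]
  linarith [h4 a b c, h4 b c a, h4 c a b, h1, h2, h3]

lemma riemann_bianchi (hG : IsMetricOn Ω G) (hz : z ∈ Ω) (a b c d : Fin n) :
    riemann G a b c d z + riemann G b c a d z + riemann G c a b d z = 0 := by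
  simp only [riemann, ← Finset.sum_add_distrib, ← mul_add, hG.riemannUp_bianchi hz, mul_zero,
    Finset.sum_const_zero]

/-- Antisymmetry of the curvature in the last two indices: the Ricci identity for the parallel
tensor `G`. -/
lemma riemann_antisymm_right (hG : IsMetricOn Ω G) (hz : z ∈ Ω) (a b c d : Fin n) :
    riemann G a b c d z = - riemann G a b d c z := by
  have h0 : ∀ a b, covCovTensor G G a b c d z = 0 := by
    intro a b
    have h1 : pd a (covTensor G G b c d) z = 0 := by
      rw [pd_congr_on hG.isOpen (g := fun _ => 0) (fun w hw => hG.covTensor_self hw b c d) hz]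
      simp [pd]
    simp [covCovTensor, h1, hG.covTensor_self hz]
  have h1 := hG.covCovTensor_sub_comm hG.smooth hz a b c d
  rw [h0, h0] at h1
  have h2 : riemann G a b c d z = ∑ m, riemannUp G a b c m z * G z m d :=
    Finset.sum_congr rfl fun m _ => by rw [hG.symm z hz d m, mul_comm]
  have h3 : riemann G a b d c z = ∑ m, riemannUp G a b d m z * G z c m :=
    Finset.sum_congr rfl fun m _ => mul_comm _ _
  linarith

/-- Pair symmetry: the sum of the four cyclic instances of the Bianchi identity, simplified by the
antisymmetries. -/
lemma riemann_pair_symm (hG : IsMetricOn Ω G) (hz : z ∈ Ω) (a b c d : Fin n) :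
    riemann G a b c d z = riemann G c d a b z := by
  have hL := riemann_antisymm_left (G := G) (z := z)
  linarith [hG.riemann_bianchi hz a b c d, hG.riemann_bianchi hz b c d a,
    hG.riemann_bianchi hz c d a b, hG.riemann_bianchi hz d a b c,
    hG.riemann_antisymm_right hz a b c d, hG.riemann_antisymm_right hz b c a d,
    hG.riemann_antisymm_right hz c a b d, hG.riemann_antisymm_right hz b c d a,
    hG.riemann_antisymm_right hz c d b a, hG.riemann_antisymm_right hz d b c a,
    hG.riemann_antisymm_right hz d a c b, hG.riemann_antisymm_right hz a c d b,
    hL a c b d, hL a c d b, hL d b a c, hL d b c a, hL d a b c,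
    hL d a c b, hL b c d a, hL b c a d, hL d c a b, hL a b c d]

/-- Raising the last index of the curvature. -/
lemma riemannUp_eq_sum (hG : IsMetricOn Ω G) (hz : z ∈ Ω) (a b c m : Fin n) :
    riemannUp G a b c m z = ∑ q, (G z)⁻¹ m q * riemann G a b c q z :=
  (hG.sum_inv_mul_mul hz (fun m => riemannUp G a b c m z) m).symm

/-- The Ricci tensor as a metric contraction of the curvature. -/
lemma ricci_eq_sum (hG : IsMetricOn Ω G) (hz : z ∈ Ω) (j k : Fin n) :
    ricci G j k z = ∑ p, ∑ q, (G z)⁻¹ p q * riemann G p j k q z :=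
  Finset.sum_congr rfl fun p _ => hG.riemannUp_eq_sum hz p j k p

end IsMetricOn

end

/-! ### Linearization of the connection, the Ricci tensor and the DeTurck form -/

section

variable {n : ℕ}

/-- The variation `½ (∇ⱼ hₖₗ + ∇ₖ hⱼₗ - ∇ₗ hⱼₖ)` of the Christoffel symbols under a variation `h`
of the metric `G`, with the upper index lowered to `l`, which comes first. -/
def varChristoffelLow (G h : Coord n → Matrix (Fin n) (Fin n) ℝ) (l j k : Fin n)
    (z : Coord n) : ℝ :=
  1 / 2 * (covTensor G h j k l z + covTensor G h k j l z - covTensor G h l j k z)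

/-- The variation of the Christoffel symbols `Γᵖⱼₖ` under a variation `h` of the metric. -/
def varChristoffel (G h : Coord n → Matrix (Fin n) (Fin n) ℝ) (p j k : Fin n) (z : Coord n) : ℝ :=
  ∑ l, (G z)⁻¹ p l * varChristoffelLow G h l j k z

/-- The variation of the Ricci tensor `Rⱼₖ` under a variation `h` of the metric. -/
def varRicci (G h : Coord n → Matrix (Fin n) (Fin n) ℝ) (j k : Fin n) (z : Coord n) : ℝ :=
  ∑ p, (pd p (varChristoffel G h p j k) z - pd j (varChristoffel G h p p k) z
    + ∑ m, (varChristoffel G h m j k z * christoffel G p p m z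
      + christoffel G m j k z * varChristoffel G h p p m z)
    - ∑ m, (varChristoffel G h m p k z * christoffel G p j m z
      + christoffel G m p k z * varChristoffel G h p j m z))

/-- The variation of the DeTurck form under a variation `h` of the metric, at the background
metric. -/
def varDeTurckForm (G h : Coord n → Matrix (Fin n) (Fin n) ℝ) (z : Coord n) (l : Fin n) : ℝ :=
  ∑ k, ∑ i, ∑ j, G z l k * (G z)⁻¹ i j * varChristoffel G h k i j z

lemma sum_sum_sum_sum_swap {ι : Type*} [Fintype ι] (f : ι → ι → ι → ι → ℝ) :
    ∑ a, ∑ b, ∑ c, ∑ d, f a b c d = ∑ a, ∑ b, ∑ c, ∑ d, f b a d c := by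
  rw [Finset.sum_comm]
  exact Finset.sum_congr rfl fun a _ => Finset.sum_congr rfl fun b _ => Finset.sum_comm

namespace IsMetricOn

variable {Ω : Set (Coord n)} {G h : Coord n → Matrix (Fin n) (Fin n) ℝ} {z : Coord n}

lemma sum_inv_mul_comm (hG : IsMetricOn Ω G) (hz : z ∈ Ω) (f : Fin n → Fin n → ℝ) :
    ∑ p, ∑ l, (G z)⁻¹ p l * f p l = ∑ p, ∑ l, (G z)⁻¹ p l * f l p := by
  rw [Finset.sum_comm]
  exact Finset.sum_congr rfl fun p _ => Finset.sum_congr rfl fun l _ => by rw [hG.inv_symm hz]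

/-- Contraction of the last two indices of a `3`-tensor commutes with covariant
differentiation. -/
lemma cov_contract (hG : IsMetricOn Ω G) (hz : z ∈ Ω) (i k : Fin n)
    {t : Fin n → Fin n → Fin n → Coord n → ℝ} (ht : ∀ k p l, DifferentiableAt ℝ (t k p l) z) :
    pd i (fun w => ∑ p, ∑ l, (G w)⁻¹ p l * t k p l w) z
        - ∑ m, christoffel G m i k z * ∑ p, ∑ l, (G z)⁻¹ p l * t m p l z =
      ∑ p, ∑ l, (G z)⁻¹ p l * (pd i (t k p l) z - ∑ m, christoffel G m i k z * t m p l z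
        - ∑ m, christoffel G m i p z * t k m l z - ∑ m, christoffel G m i l z * t k p m z) := by
  rw [hG.pd_sum_sum_inv_mul hz i (ht k)]
  have e : ∑ m, christoffel G m i k z * ∑ p, ∑ l, (G z)⁻¹ p l * t m p l z =
      ∑ p, ∑ l, (G z)⁻¹ p l * ∑ m, christoffel G m i k z * t m p l z := by
    simp only [Finset.mul_sum]
    rw [Finset.sum_comm]
    refine Finset.sum_congr rfl fun p _ => ?_
    rw [Finset.sum_comm]
    exact Finset.sum_congr rfl fun l _ => Finset.sum_congr rfl fun m _ => by ring
  rw [e]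
  simp only [← Finset.sum_sub_distrib, ← mul_sub]
  exact Finset.sum_congr rfl fun p _ => Finset.sum_congr rfl fun l _ => by ring

lemma covTensor_symm (hG : IsMetricOn Ω G) (hs : ∀ z ∈ Ω, ∀ i j, h z i j = h z j i) (hz : z ∈ Ω)
    (k i j : Fin n) : covTensor G h k i j z = covTensor G h k j i z := by
  have h1 := pd_congr_on hG.isOpen (fun w hw => hs w hw i j) hz k
  simp only [covTensor, h1, hs z hz _ j, hs z hz i]
  ring

lemma covCovTensor_symm (hG : IsMetricOn Ω G) (hs : ∀ z ∈ Ω, ∀ i j, h z i j = h z j i)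
    (hz : z ∈ Ω) (l k i j : Fin n) :
    covCovTensor G h l k i j z = covCovTensor G h l k j i z := by
  have h1 := pd_congr_on hG.isOpen (fun w hw => hG.covTensor_symm hs hw k i j) hz l
  simp only [covCovTensor, h1, hG.covTensor_symm hs hz _ _ j, hG.covTensor_symm hs hz _ i]
  ring

lemma varChristoffelLow_eq (hG : IsMetricOn Ω G) (hs : ∀ z ∈ Ω, ∀ i j, h z i j = h z j i)
    (hz : z ∈ Ω) (k i j : Fin n) :
    varChristoffelLow G h k i j z =
      1 / 2 * (pd i (fun w => h w j k) z + pd j (fun w => h w i k) z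
        - pd k (fun w => h w i j) z) - ∑ m, h z k m * christoffel G m i j z := by
  have h1 : ∑ m, christoffel G m i j z * h z m k = ∑ m, h z k m * christoffel G m i j z :=
    Finset.sum_congr rfl fun m _ => by rw [hs z hz m k, mul_comm]
  have h2 : ∑ m, christoffel G m j i z * h z m k = ∑ m, h z k m * christoffel G m i j z :=
    Finset.sum_congr rfl fun m _ => by rw [hs z hz m k, hG.christoffel_symm hz, mul_comm]
  have h3 : ∑ m, christoffel G m i k z * h z j m = ∑ m, christoffel G m k i z * h z m j :=
    Finset.sum_congr rfl fun m _ => by rw [hs z hz m j, hG.christoffel_symm hz]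
  have h4 : ∑ m, christoffel G m j k z * h z i m = ∑ m, christoffel G m k j z * h z i m :=
    Finset.sum_congr rfl fun m _ => by rw [hG.christoffel_symm hz]
  rw [varChristoffelLow, covTensor, covTensor, covTensor, h1, h2, h3, h4]
  ring

lemma contDiffAt_varChristoffelLow (hG : IsMetricOn Ω G)
    (hh : ∀ i j, ∀ z ∈ Ω, ContDiffAt ℝ ∞ (fun w => h w i j) z) (hz : z ∈ Ω) (l j k : Fin n) :
    ContDiffAt ℝ ∞ (varChristoffelLow G h l j k) z :=
  contDiffAt_const.mul (((hG.contDiffAt_covTensor hh hz j k l).add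
    (hG.contDiffAt_covTensor hh hz k j l)).sub (hG.contDiffAt_covTensor hh hz l j k))

lemma contDiffAt_varChristoffel (hG : IsMetricOn Ω G)
    (hh : ∀ i j, ∀ z ∈ Ω, ContDiffAt ℝ ∞ (fun w => h w i j) z) (hz : z ∈ Ω) (p j k : Fin n) :
    ContDiffAt ℝ ∞ (varChristoffel G h p j k) z :=
  ContDiffAt.sum fun l _ => (hG.contDiffAt_inv hz p l).mul
    (hG.contDiffAt_varChristoffelLow hh hz l j k)

/-- The divergence of the variation of the connection, in terms of the second covariant
derivatives of `h`. -/
lemma sum_pd_varChristoffel (hG : IsMetricOn Ω G)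
    (hh : ∀ i j, ∀ z ∈ Ω, ContDiffAt ℝ ∞ (fun w => h w i j) z) (hz : z ∈ Ω) (j k : Fin n) :
    ∑ p, (pd p (varChristoffel G h p j k) z
        + ∑ m, varChristoffel G h m j k z * christoffel G p p m z
        - ∑ m, (varChristoffel G h m p k z * christoffel G p j m z
          + christoffel G m p k z * varChristoffel G h p j m z)) =
      ∑ p, ∑ l, (G z)⁻¹ p l * (1 / 2 * (covCovTensor G h p j k l z + covCovTensor G h p k j l z
        - covCovTensor G h p l j k z)) := by
  have hd := fun l j k => (hG.contDiffAt_varChristoffelLow hh hz l j k).differentiableAt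
    (by simp : (∞ : ℕ∞ω) ≠ 0)
  have hC := fun l j k => (hG.contDiffAt_covTensor hh hz l j k).differentiableAt
    (by simp : (∞ : ℕ∞ω) ≠ 0)
  have e1 : ∀ p, pd p (varChristoffel G h p j k) z
        + ∑ m, varChristoffel G h m j k z * christoffel G p p m z =
      ∑ l, (G z)⁻¹ p l * (pd p (varChristoffelLow G h l j k) z
        - ∑ m, christoffel G m p l z * varChristoffelLow G h m j k z) := by
    intro p
    have := hG.pd_sum_inv_mul hz p p (fun l => hd l j k)
    have e : ∑ m, varChristoffel G h m j k z * christoffel G p p m z =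
        ∑ m, christoffel G p p m z * ∑ l, (G z)⁻¹ m l * varChristoffelLow G h l j k z :=
      Finset.sum_congr rfl fun m _ => mul_comm _ _
    rw [e]
    exact eq_sub_iff_add_eq.mp this
  have e2 : ∑ p, ∑ m, varChristoffel G h m p k z * christoffel G p j m z =
      ∑ p, ∑ l, (G z)⁻¹ p l * ∑ m, christoffel G m p j z * varChristoffelLow G h l m k z := by
    rw [Finset.sum_comm]
    refine Finset.sum_congr rfl fun p _ => ?_
    simp only [varChristoffel, Finset.mul_sum, Finset.sum_mul]
    rw [Finset.sum_comm]
    exact Finset.sum_congr rfl fun l _ => Finset.sum_congr rfl fun m _ => by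
      rw [hG.christoffel_symm hz m j p]; ring
  have e3 : ∑ p, ∑ m, christoffel G m p k z * varChristoffel G h p j m z =
      ∑ p, ∑ l, (G z)⁻¹ p l * ∑ m, christoffel G m p k z * varChristoffelLow G h l j m z := by
    refine Finset.sum_congr rfl fun p _ => ?_
    simp only [varChristoffel, Finset.mul_sum]
    rw [Finset.sum_comm]
    exact Finset.sum_congr rfl fun l _ => Finset.sum_congr rfl fun m _ => by ring
  simp only [e1, Finset.sum_sub_distrib, Finset.sum_add_distrib]
  rw [e2, e3]
  simp only [← Finset.sum_sub_distrib, ← Finset.sum_add_distrib, ← mul_sub, ← mul_add]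
  refine Finset.sum_congr rfl fun p _ => Finset.sum_congr rfl fun l _ => ?_
  have e4 : pd p (varChristoffelLow G h l j k) z = 1 / 2 * (pd p (covTensor G h j k l) z
      + pd p (covTensor G h k j l) z - pd p (covTensor G h l j k) z) := by
    rw [← pd_add _ (hC j k l) (hC k j l), ← pd_sub _ ((hC j k l).fun_add (hC k j l)) (hC l j k),
      ← pd_const_mul _ _ (((hC j k l).fun_add (hC k j l)).fun_sub (hC l j k))]
    rfl
  have e5 : ∀ (c : Fin n → ℝ) (x y w : Fin n → ℝ), ∑ m, c m * (1 / 2 * (x m + y m - w m)) =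
      1 / 2 * (∑ m, c m * x m + ∑ m, c m * y m - ∑ m, c m * w m) := by
    intro c x y w
    rw [← Finset.sum_add_distrib, ← Finset.sum_sub_distrib, Finset.mul_sum]
    exact Finset.sum_congr rfl fun m _ => by ring
  rw [e4]
  simp only [varChristoffelLow, Finset.sum_add_distrib, e5, covCovTensor]
  ring

/-- The trace of the variation of the connection is half the differential of the trace of `h`. -/
lemma sum_varChristoffel (hG : IsMetricOn Ω G) (hs : ∀ z ∈ Ω, ∀ i j, h z i j = h z j i)
    (hz : z ∈ Ω) (k : Fin n) :
    ∑ p, varChristoffel G h p p k z =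
      ∑ p, ∑ l, (G z)⁻¹ p l * (1 / 2 * covTensor G h k p l z) := by
  have e := hG.sum_inv_mul_comm hz fun p l => 1 / 2 * covTensor G h p k l z
  have e2 : ∑ p, varChristoffel G h p p k z =
      ∑ p, ∑ l, (G z)⁻¹ p l * (1 / 2 * covTensor G h k p l z)
        + ∑ p, ∑ l, (G z)⁻¹ p l * (1 / 2 * covTensor G h p k l z)
        - ∑ p, ∑ l, (G z)⁻¹ p l * (1 / 2 * covTensor G h l k p z) := by
    simp only [varChristoffel, varChristoffelLow, ← Finset.sum_sub_distrib,
      ← Finset.sum_add_distrib, ← mul_sub, ← mul_add]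
    refine Finset.sum_congr rfl fun p _ => Finset.sum_congr rfl fun l _ => ?_
    rw [hG.covTensor_symm hs hz l p k]
    ring
  rw [e2, e]
  ring

lemma varRicci_eq (hG : IsMetricOn Ω G)
    (hh : ∀ i j, ∀ z ∈ Ω, ContDiffAt ℝ ∞ (fun w => h w i j) z)
    (hs : ∀ z ∈ Ω, ∀ i j, h z i j = h z j i) (hz : z ∈ Ω) (j k : Fin n) :
    varRicci G h j k z =
      ∑ p, ∑ l, (G z)⁻¹ p l * (1 / 2 * (covCovTensor G h p j k l z + covCovTensor G h p k j l z
        - covCovTensor G h p l j k z)) -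
      ∑ p, ∑ l, (G z)⁻¹ p l * (1 / 2 * covCovTensor G h j k p l z) := by
  have hC := fun l j k => (hG.contDiffAt_covTensor hh hz l j k).differentiableAt
    (by simp : (∞ : ℕ∞ω) ≠ 0)
  have e1 : ∑ p, pd j (varChristoffel G h p p k) z =
      pd j (fun w => ∑ p, ∑ l, (G w)⁻¹ p l * (1 / 2 * covTensor G h k p l w)) z := by
    rw [← pd_sum _ fun p _ =>
      (hG.contDiffAt_varChristoffel hh hz p p k).differentiableAt (by simp)]
    exact pd_congr_on hG.isOpen (fun w hw => hG.sum_varChristoffel hs hw k) hz j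
  have e2 : ∑ p, ∑ m, christoffel G m j k z * varChristoffel G h p p m z =
      ∑ m, christoffel G m j k z *
        ∑ p, ∑ l, (G z)⁻¹ p l * (1 / 2 * covTensor G h m p l z) := by
    rw [Finset.sum_comm]
    refine Finset.sum_congr rfl fun m _ => ?_
    rw [← Finset.mul_sum, hG.sum_varChristoffel hs hz]
  have e3 := hG.cov_contract hz j k (t := fun k p l w => 1 / 2 * covTensor G h k p l w)
    (fun k p l => (hC k p l).const_mul _)
  have e4 : ∀ p l, pd j (fun w => 1 / 2 * covTensor G h k p l w) z
      - ∑ m, christoffel G m j k z * (1 / 2 * covTensor G h m p l z)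
      - ∑ m, christoffel G m j p z * (1 / 2 * covTensor G h k m l z)
      - ∑ m, christoffel G m j l z * (1 / 2 * covTensor G h k p m z) =
      1 / 2 * covCovTensor G h j k p l z := by
    intro p l
    rw [pd_const_mul _ _ (hC k p l), covCovTensor]
    simp only [mul_left_comm _ (1 / 2 : ℝ), ← Finset.mul_sum]
    ring
  simp only [e4] at e3
  rw [← hG.sum_pd_varChristoffel hh hz, ← e3, ← e1, ← e2]
  simp only [varRicci, ← Finset.sum_sub_distrib, Finset.sum_add_distrib]
  simp only [Finset.sum_sub_distrib, Finset.sum_add_distrib]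
  ring

lemma varDeTurckForm_eq (hG : IsMetricOn Ω G) (hz : z ∈ Ω) (l : Fin n) :
    varDeTurckForm G h z l =
      ∑ p, ∑ q, (G z)⁻¹ p q * (covTensor G h p q l z - 1 / 2 * covTensor G h l p q z) := by
  have e1 : varDeTurckForm G h z l =
      ∑ p, ∑ q, (G z)⁻¹ p q * varChristoffelLow G h l p q z := by
    rw [varDeTurckForm, Finset.sum_comm]
    refine Finset.sum_congr rfl fun p _ => ?_
    rw [Finset.sum_comm]
    refine Finset.sum_congr rfl fun q _ => ?_
    rw [← hG.sum_mul_inv_mul hz (fun l => varChristoffelLow G h l p q z) l, Finset.mul_sum]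
    exact Finset.sum_congr rfl fun m _ => by rw [varChristoffel]; ring
  have e2 := hG.sum_inv_mul_comm hz fun p q => 1 / 2 * covTensor G h p q l z
  have e3 : ∑ p, ∑ q, (G z)⁻¹ p q * varChristoffelLow G h l p q z =
      ∑ p, ∑ q, (G z)⁻¹ p q * (1 / 2 * covTensor G h p q l z)
      + ∑ p, ∑ q, (G z)⁻¹ p q * (1 / 2 * covTensor G h q p l z)
      - ∑ p, ∑ q, (G z)⁻¹ p q * (1 / 2 * covTensor G h l p q z) := by
    simp only [varChristoffelLow, ← Finset.sum_sub_distrib, ← Finset.sum_add_distrib,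
      ← mul_sub, ← mul_add]
  rw [e1, e3, ← e2]
  simp only [← Finset.sum_sub_distrib, ← Finset.sum_add_distrib]
  exact Finset.sum_congr rfl fun p _ => Finset.sum_congr rfl fun q _ => by ring

lemma covOneForm_varDeTurckForm (hG : IsMetricOn Ω G)
    (hh : ∀ i j, ∀ z ∈ Ω, ContDiffAt ℝ ∞ (fun w => h w i j) z) (hz : z ∈ Ω) (i j : Fin n) :
    covOneForm G (varDeTurckForm G h) i j z =
      ∑ p, ∑ q, (G z)⁻¹ p q *
        (covCovTensor G h i p q j z - 1 / 2 * covCovTensor G h i j p q z) := by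
  have hC := fun l j k => (hG.contDiffAt_covTensor hh hz l j k).differentiableAt
    (by simp : (∞ : ℕ∞ω) ≠ 0)
  have e3 := hG.cov_contract hz i j
    (t := fun k p q w => covTensor G h p q k w - 1 / 2 * covTensor G h k p q w)
    (fun k p q => (hC p q k).fun_sub ((hC k p q).const_mul _))
  rw [covOneForm, pd_congr_on hG.isOpen (fun w hw => hG.varDeTurckForm_eq hw j) hz i]
  simp only [hG.varDeTurckForm_eq hz]
  rw [e3]
  refine Finset.sum_congr rfl fun p _ => Finset.sum_congr rfl fun q _ => ?_
  congr 1
  rw [pd_sub _ (hC p q j) ((hC j p q).const_mul _), pd_const_mul _ _ (hC j p q)]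
  simp only [mul_sub, Finset.sum_sub_distrib, mul_left_comm _ (1 / 2 : ℝ), ← Finset.mul_sum,
    covCovTensor]
  ring

end IsMetricOn

end

/-! ### Linearization of the modified Ricci flow -/

section

variable {n : ℕ}

namespace IsMetricOn

variable {Ω : Set (Coord n)} {G h : Coord n → Matrix (Fin n) (Fin n) ℝ} {z : Coord n}

/-- The curvature term `Rₖᵢⱼₗ hₖₗ`, in the form in which it arises from the Ricci identity. -/
lemma sum_inv_mul_sum_riemannUp_mul (hG : IsMetricOn Ω G) (hs : ∀ z ∈ Ω, ∀ i j, h z i j = h z j i)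
    (hz : z ∈ Ω) (i j : Fin n) :
    ∑ p, ∑ l, (G z)⁻¹ p l * ∑ m, riemannUp G p i j m z * h z m l =
      ∑ k, ∑ l, ∑ p, ∑ q, (G z)⁻¹ k p * (G z)⁻¹ l q * riemann G k i j l z * h z p q := by
  refine Finset.sum_congr rfl fun k _ => ?_
  rw [Finset.sum_comm]
  refine Finset.sum_congr rfl fun p _ => ?_
  simp only [hG.riemannUp_eq_sum hz, Finset.sum_mul, Finset.mul_sum]
  rw [Finset.sum_comm]
  refine Finset.sum_congr rfl fun l _ => Finset.sum_congr rfl fun q _ => ?_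
  rw [hs z hz q p, hG.inv_symm hz q l]
  ring

/-- The curvature term `Rₖᵢⱼₗ hₖₗ` is symmetric in `i` and `j`. -/
lemma sum_riemann_mul_symm (hG : IsMetricOn Ω G) (hs : ∀ z ∈ Ω, ∀ i j, h z i j = h z j i)
    (hz : z ∈ Ω) (i j : Fin n) :
    ∑ k, ∑ l, ∑ p, ∑ q, (G z)⁻¹ k p * (G z)⁻¹ l q * riemann G k i j l z * h z p q =
      ∑ k, ∑ l, ∑ p, ∑ q, (G z)⁻¹ k p * (G z)⁻¹ l q * riemann G k j i l z * h z p q := by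
  rw [sum_sum_sum_sum_swap]
  refine Finset.sum_congr rfl fun k _ => Finset.sum_congr rfl fun l _ =>
    Finset.sum_congr rfl fun p _ => Finset.sum_congr rfl fun q _ => ?_
  have e : riemann G l i j k z = riemann G k j i l z := by
    rw [hG.riemann_pair_symm hz l i j k, riemann_antisymm_left, hG.riemann_antisymm_right hz]
    ring
  rw [e, hs z hz q p]
  ring

/-- The curvature term `Rᵢₖ hₖⱼ`, in the form in which it arises from the Ricci identity. -/
lemma sum_inv_mul_sum_riemannUp_mul' (hG : IsMetricOn Ω G)
    (hs : ∀ z ∈ Ω, ∀ i j, h z i j = h z j i) (hz : z ∈ Ω) (i j : Fin n) :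
    ∑ p, ∑ l, (G z)⁻¹ p l * ∑ m, riemannUp G p i l m z * h z j m =
      - ∑ k, ∑ l, (G z)⁻¹ k l * ricci G i k z * h z l j := by
  have e : ∀ k l, (G z)⁻¹ k l * ricci G i k z * h z l j =
      - ∑ p, ∑ q, (G z)⁻¹ p q * ((G z)⁻¹ l k * riemann G p i q k z * h z j l) := by
    intro k l
    rw [hG.ricci_eq_sum hz, Finset.mul_sum, Finset.sum_mul, ← Finset.sum_neg_distrib]
    refine Finset.sum_congr rfl fun p _ => ?_
    rw [Finset.mul_sum, Finset.sum_mul, ← Finset.sum_neg_distrib]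
    refine Finset.sum_congr rfl fun q _ => ?_
    rw [hs z hz l j, hG.inv_symm hz k l, hG.riemann_antisymm_right hz p i k q]
    ring
  simp only [e, Finset.sum_neg_distrib, neg_neg, hG.riemannUp_eq_sum hz, Finset.sum_mul,
    Finset.mul_sum]
  rw [Finset.sum_comm (s := Finset.univ (α := Fin n)) (t := Finset.univ (α := Fin n))
    (f := fun k l => ∑ p, ∑ q, (G z)⁻¹ p q * ((G z)⁻¹ l k * riemann G p i q k z * h z j l))]
  have e2 : ∀ f : Fin n → Fin n → Fin n → Fin n → ℝ,
      ∑ a, ∑ b, ∑ c, ∑ d, f a b c d = ∑ c, ∑ d, ∑ a, ∑ b, f a b c d := by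
    intro f
    have h1 := Finset.sum_comm (s := Finset.univ) (t := Finset.univ)
      (f := fun x y : Fin n × Fin n => f x.1 x.2 y.1 y.2)
    simpa only [Fintype.sum_prod_type] using h1
  rw [e2]

/-- The contraction of the curvature, in its antisymmetric pair of last indices, with a symmetric
tensor vanishes. -/
lemma sum_riemannUp_mul_eq_zero (hG : IsMetricOn Ω G) (hs : ∀ z ∈ Ω, ∀ i j, h z i j = h z j i)
    (hz : z ∈ Ω) (i j : Fin n) :
    ∑ p, ∑ l, (G z)⁻¹ p l * ∑ m, riemannUp G i j p m z * h z m l = 0 := by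
  have e : ∑ p, ∑ l, (G z)⁻¹ p l * ∑ m, riemannUp G i j p m z * h z m l =
      ∑ p, ∑ q, ∑ l, ∑ m, (G z)⁻¹ p l * (G z)⁻¹ q m * riemann G i j p q z * h z l m := by
    refine Finset.sum_congr rfl fun p _ => ?_
    rw [Finset.sum_comm]
    refine Finset.sum_congr rfl fun l _ => ?_
    simp only [hG.riemannUp_eq_sum hz, Finset.sum_mul, Finset.mul_sum]
    rw [Finset.sum_comm]
    refine Finset.sum_congr rfl fun q _ => Finset.sum_congr rfl fun m _ => ?_
    rw [hs z hz m l, hG.inv_symm hz m q]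
    ring
  have e2 : ∑ p, ∑ q, ∑ l, ∑ m, (G z)⁻¹ p l * (G z)⁻¹ q m * riemann G i j p q z * h z l m =
      - ∑ p, ∑ q, ∑ l, ∑ m, (G z)⁻¹ p l * (G z)⁻¹ q m * riemann G i j p q z * h z l m := by
    conv_lhs => rw [sum_sum_sum_sum_swap]
    simp only [← Finset.sum_neg_distrib]
    refine Finset.sum_congr rfl fun p _ => Finset.sum_congr rfl fun q _ =>
      Finset.sum_congr rfl fun l _ => Finset.sum_congr rfl fun m _ => ?_
    rw [hG.riemann_antisymm_right hz i j q p, hs z hz m l]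
    ring
  rw [e]
  linarith

/-- The linearization of DeTurck's operator at the background metric is the Lichnerowicz
Laplacian: the second derivatives other than the Laplacian cancel up to commutators, which are
curvature terms by the Ricci identity. -/
theorem varRicci_add_covOneForm_eq_lichnerowicz (hG : IsMetricOn Ω G)
    (hh : ∀ i j, ∀ z ∈ Ω, ContDiffAt ℝ ∞ (fun w => h w i j) z)
    (hs : ∀ z ∈ Ω, ∀ i j, h z i j = h z j i) (hz : z ∈ Ω) (i j : Fin n) :
    -2 * varRicci G h i j z + covOneForm G (varDeTurckForm G h) i j z
      + covOneForm G (varDeTurckForm G h) j i z = lichnerowicz G h i j z := by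
  have hterm : ∀ p l, (-2 : ℝ) * ((1 / 2 * (covCovTensor G h p i j l z + covCovTensor G h p j i l z
        - covCovTensor G h p l i j z)) - 1 / 2 * covCovTensor G h i j p l z)
      + (covCovTensor G h i p l j z - 1 / 2 * covCovTensor G h i j p l z)
      + (covCovTensor G h j p l i z - 1 / 2 * covCovTensor G h j i p l z) =
      covCovTensor G h p l i j z
      + (∑ m, riemannUp G p i j m z * h z m l + ∑ m, riemannUp G p i l m z * h z j m)
      + (∑ m, riemannUp G p j i m z * h z m l + ∑ m, riemannUp G p j l m z * h z i m)
      - 1 / 2 * (∑ m, riemannUp G i j p m z * h z m l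
        + ∑ m, riemannUp G i j l m z * h z m p) := by
    intro p l
    have h1 := hG.covCovTensor_sub_comm hh hz p i j l
    have h2 := hG.covCovTensor_sub_comm hh hz p j i l
    have h3 := hG.covCovTensor_sub_comm hh hz i j p l
    have h4 : ∑ m, riemannUp G i j l m z * h z p m = ∑ m, riemannUp G i j l m z * h z m p :=
      Finset.sum_congr rfl fun m _ => by rw [hs z hz p m]
    rw [hG.covCovTensor_symm hs hz i p l j, hG.covCovTensor_symm hs hz j p l i]
    linarith
  have h0 := hG.sum_riemannUp_mul_eq_zero hs hz i j
  have h0' := h0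
  rw [hG.sum_inv_mul_comm hz fun p l => ∑ m, riemannUp G i j p m z * h z m l] at h0'
  have hsum : -2 * varRicci G h i j z + covOneForm G (varDeTurckForm G h) i j z
      + covOneForm G (varDeTurckForm G h) j i z =
      ∑ p, ∑ l, (G z)⁻¹ p l * (covCovTensor G h p l i j z
      + (∑ m, riemannUp G p i j m z * h z m l + ∑ m, riemannUp G p i l m z * h z j m)
      + (∑ m, riemannUp G p j i m z * h z m l + ∑ m, riemannUp G p j l m z * h z i m)
      - 1 / 2 * (∑ m, riemannUp G i j p m z * h z m l
        + ∑ m, riemannUp G i j l m z * h z m p)) := by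
    simp only [← hterm]
    rw [hG.varRicci_eq hh hs hz, hG.covOneForm_varDeTurckForm hh hz,
      hG.covOneForm_varDeTurckForm hh hz]
    simp only [← Finset.sum_sub_distrib, ← Finset.sum_add_distrib, Finset.mul_sum]
    exact Finset.sum_congr rfl fun p _ => Finset.sum_congr rfl fun l _ => by ring
  have hhalf : ∀ f : Fin n → Fin n → ℝ, ∑ p, ∑ l, (G z)⁻¹ p l * (1 / 2 * f p l) =
      1 / 2 * ∑ p, ∑ l, (G z)⁻¹ p l * f p l := by
    intro f
    simp only [Finset.mul_sum]
    exact Finset.sum_congr rfl fun p _ => Finset.sum_congr rfl fun l _ => by ring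
  rw [hsum]
  simp only [mul_add, mul_sub, Finset.sum_add_distrib, Finset.sum_sub_distrib, hhalf]
  rw [hG.sum_inv_mul_sum_riemannUp_mul hs hz i j, hG.sum_inv_mul_sum_riemannUp_mul hs hz j i,
    hG.sum_riemann_mul_symm hs hz j i, hG.sum_inv_mul_sum_riemannUp_mul' hs hz i j,
    hG.sum_inv_mul_sum_riemannUp_mul' hs hz j i, h0, h0', lichnerowicz, roughLaplacian]
  ring

end IsMetricOn

section Family

variable {Ω : Set (Coord n)} {F : ℝ → Coord n → Matrix (Fin n) (Fin n) ℝ}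
  {h : Coord n → Matrix (Fin n) (Fin n) ℝ}

/-- The first variation of the Christoffel symbols. -/
lemma hasVariation_christoffel (hF : ∀ᶠ s in 𝓝 (0 : ℝ), IsMetricOn Ω (F s))
    (hv : ∀ i j, HasVariation Ω (fun s z => F s z i j) (fun z => h z i j))
    (hs : ∀ z ∈ Ω, ∀ i j, h z i j = h z j i) (k i j : Fin n) :
    HasVariation Ω (fun s => christoffel (F s) k i j) (varChristoffel (F 0) h k i j) := by
  have hG := hF.self_of_nhds
  have hpd := fun l i j => (hv i j).pd hG.isOpen l
  have hΓ : ∀ k, HasVariation Ω (fun s => christoffel (F s) k i j) _ := fun k =>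
    HasVariation.of_contDiffAt fun z hz => contDiffAt_const.mul (ContDiffAt.sum fun l _ =>
      (contDiffAt_inv_apply (A := fun q : ℝ × Coord n => F q.1 q.2)
        (fun a b => (hv a b).smooth z hz) (hG.unit z hz) k l).mul
        ((((hpd i j l).smooth z hz).add ((hpd j i l).smooth z hz)).sub
          ((hpd l i j).smooth z hz)))
  refine (hΓ k).congr_right fun z hz => ?_
  -- differentiate the formula for the Christoffel symbols of the first kind
  have hlow : ∀ l, ∑ m, F 0 z l m * deriv (fun s => christoffel (F s) m i j z) 0 =
      varChristoffelLow (F 0) h l i j z := by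
    intro l
    have h1 := (HasVariation.sum fun m (_ : m ∈ Finset.univ) => (hv l m).mul (hΓ m)).deriv z hz
    have h2 := ((((hpd i j l).add (hpd j i l)).sub (hpd l i j)).const_mul (1 / 2)).deriv z hz
    have h3 : (fun s => ∑ m, F s z l m * christoffel (F s) m i j z) =ᶠ[𝓝 0] fun s =>
        1 / 2 * (pd i (fun w => F s w j l) z + pd j (fun w => F s w i l) z
          - pd l (fun w => F s w i j) z) := by
      filter_upwards [hF] with s hs using hs.sum_mul_christoffel hz l i j
    have h4 := h1.unique (h2.congr_of_eventuallyEq h3)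
    rw [Finset.sum_add_distrib] at h4
    rw [hG.varChristoffelLow_eq hs hz]
    linarith
  rw [varChristoffel]
  simp only [← hlow]
  exact (hG.sum_inv_mul_mul hz (fun m => deriv (fun s => christoffel (F s) m i j z) 0) k).symm

/-- The first variation of the Ricci tensor. -/
lemma hasVariation_ricci (hF : ∀ᶠ s in 𝓝 (0 : ℝ), IsMetricOn Ω (F s))
    (hv : ∀ i j, HasVariation Ω (fun s z => F s z i j) (fun z => h z i j))
    (hs : ∀ z ∈ Ω, ∀ i j, h z i j = h z j i) (j k : Fin n) :
    HasVariation Ω (fun s => ricci (F s) j k) (varRicci (F 0) h j k) := by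
  have hΩ := hF.self_of_nhds.isOpen
  have hΓ := hasVariation_christoffel hF hv hs
  refine HasVariation.congr_right (HasVariation.sum fun p _ =>
    ((((hΓ p j k).pd hΩ p).sub ((hΓ p p k).pd hΩ j)).add
      (HasVariation.sum fun m _ => (hΓ m j k).mul (hΓ p p m))).sub
      (HasVariation.sum fun m _ => (hΓ m p k).mul (hΓ p j m))) fun z _ => rfl

/-- The first variation of the DeTurck form at the background metric, where the form vanishes. -/
lemma hasVariation_deTurckForm (hF : ∀ᶠ s in 𝓝 (0 : ℝ), IsMetricOn Ω (F s))
    (hv : ∀ i j, HasVariation Ω (fun s z => F s z i j) (fun z => h z i j))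
    (hs : ∀ z ∈ Ω, ∀ i j, h z i j = h z j i) (l : Fin n) :
    HasVariation Ω (fun s z => deTurckForm (F s) (F 0) z l)
      (fun z => varDeTurckForm (F 0) h z l) := by
  have hG := hF.self_of_nhds
  have hΓ := hasVariation_christoffel hF hv hs
  have hJ : ∀ i j, HasVariation Ω (fun s z => (F s z)⁻¹ i j) _ := fun i j =>
    HasVariation.of_contDiffAt fun z hz =>
      contDiffAt_inv_apply (A := fun q : ℝ × Coord n => F q.1 q.2)
        (fun a b => (hv a b).smooth z hz) (hG.unit z hz) i j
  refine HasVariation.congr_right (HasVariation.sum fun k _ => HasVariation.sum fun i _ =>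
    HasVariation.sum fun j _ => ((hv l k).mul (hJ i j)).mul ((hΓ k i j).sub
      (HasVariation.const fun z hz => hG.contDiffAt_christoffel hz k i j))) fun z _ => ?_
  simp [varDeTurckForm]

/-- The variation of the right-hand side of the modified Ricci flow, at the background metric. -/
theorem hasDerivAt_modifiedRicci (hF : ∀ᶠ s in 𝓝 (0 : ℝ), IsMetricOn Ω (F s))
    (hv : ∀ i j, HasVariation Ω (fun s z => F s z i j) (fun z => h z i j))
    (hs : ∀ z ∈ Ω, ∀ i j, h z i j = h z j i) {z : Coord n} (hz : z ∈ Ω) (i j : Fin n) :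
    HasDerivAt (fun s => -2 * ricci (F s) i j z + covOneForm (F s) (deTurckForm (F s) (F 0)) i j z
        + covOneForm (F s) (deTurckForm (F s) (F 0)) j i z)
      (lichnerowicz (F 0) h i j z) 0 := by
  have hG := hF.self_of_nhds
  have hΓ := hasVariation_christoffel hF hv hs
  have hW := hasVariation_deTurckForm hF hv hs
  have hcov : ∀ i j, HasVariation Ω
      (fun s z => covOneForm (F s) (deTurckForm (F s) (F 0)) i j z)
      (covOneForm (F 0) (varDeTurckForm (F 0) h) i j) := by
    intro i j
    refine HasVariation.congr_right (((hW j).pd hG.isOpen i).sub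
      (HasVariation.sum fun m _ => (hΓ m i j).mul (hW m))) fun z _ => ?_
    simp [covOneForm, deTurckForm]
  rw [← hG.varRicci_add_covOneForm_eq_lichnerowicz
    (fun i j z hz => (hv i j).contDiffAt hG.isOpen hz) hs hz]
  exact ((((hasVariation_ricci hF hv hs i j).const_mul (-2)).add (hcov i j)).add
    (hcov j i)).deriv z hz

end Family

end

/-! ### Families of metrics on a manifold -/

section

lemma hasDerivAt_comp_of_mapsTo {E : Type*} [NormedAddCommGroup E] [NormedSpace ℝ E]
    {f : E → ℝ} {K : Set E} {c : ℝ → E} {w : E} {I : Set ℝ} (hI : I ∈ 𝓝 0)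
    (hf : DifferentiableWithinAt ℝ f K (c 0)) (hc : HasDerivAt c w 0) (hm : MapsTo c I K) :
    HasDerivAt (fun s => f (c s)) (fderivWithin ℝ f K (c 0) w) 0 :=
  (hf.hasFDerivWithinAt.comp_hasDerivWithinAt (0 : ℝ) hc.hasDerivWithinAt hm).hasDerivAt hI

lemma hasDerivAt_clm_apply_apply {V : Type*} [NormedAddCommGroup V] [NormedSpace ℝ V]
    {A : ℝ → V →L[ℝ] V →L[ℝ] ℝ} {A' : V →L[ℝ] V →L[ℝ] ℝ} {s : ℝ} (hA : HasDerivAt A A' s)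
    (u v : V) : HasDerivAt (fun r => A r u v) (A' u v) s := by
  have h1 := hA.clm_apply (hasDerivAt_const s u)
  simpa using h1.clm_apply (hasDerivAt_const s v)

set_option synthInstance.maxHeartbeats 200000 in
lemma hasDerivAt_clm_of_contDiffOn_apply {V : Type*} [NormedAddCommGroup V]
    [NormedSpace ℝ V] [FiniteDimensional ℝ V] {A : ℝ → V →L[ℝ] V →L[ℝ] ℝ} {I : Set ℝ} {s : ℝ}
    (hI : I ∈ 𝓝 s) (hA : ∀ u v, ContDiffOn ℝ ∞ (fun r => A r u v) I) :
    HasDerivAt A (deriv A s) s := by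
  have h : ContDiffOn ℝ ∞ A I :=
    contDiffOn_clm_apply.mpr fun u => contDiffOn_clm_apply.mpr fun v => hA u v
  exact ((h.contDiffAt hI).differentiableAt (by simp)).hasDerivAt

/-- Partial derivatives in a parameter `s` and a time `t` commute, up to and including the initial
time `t = 0`. -/
lemma hasDerivWithinAt_deriv_comm {δ t₁ t : ℝ} {f : ℝ → ℝ → ℝ} {a : ℝ → ℝ} {a' : ℝ} (hδ : 0 < δ)
    (ht : t ∈ Ico 0 t₁)
    (hf : ContDiffOn ℝ ∞ (fun p : ℝ × ℝ => f p.1 p.2) (Ioo (-δ) δ ×ˢ Ico 0 t₁))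
    (ha : ∀ s ∈ Ioo (-δ) δ, HasDerivWithinAt (f s) (a s) (Ico 0 t₁) t)
    (ha' : HasDerivAt a a' 0) :
    HasDerivWithinAt (fun r => deriv (fun s => f s r) 0) a' (Ico 0 t₁) t := by
  have ht₁ : 0 < t₁ := ht.1.trans_lt ht.2
  set K : Set (ℝ × ℝ) := Ioo (-δ) δ ×ˢ Ico 0 t₁ with hK
  set F : ℝ × ℝ → ℝ := fun p => f p.1 p.2 with hF
  have hI : Ioo (-δ) δ ∈ 𝓝 (0 : ℝ) := Ioo_mem_nhds (by linarith) hδ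
  have h0 : (0 : ℝ) ∈ Ioo (-δ) δ := ⟨by linarith, hδ⟩
  have hU : UniqueDiffOn ℝ K := (uniqueDiffOn_Ioo _ _).prod (uniqueDiffOn_Ico _ _)
  have hd : DifferentiableOn ℝ F K := hf.differentiableOn (by simp)
  have hd2 : DifferentiableOn ℝ (fderivWithin ℝ F K) K :=
    (hf.fderivWithin hU (m := ∞) (by simp)).differentiableOn (by simp)
  have hx : ((0 : ℝ), t) ∈ K := ⟨h0, ht⟩
  have hsymm : IsSymmSndFDerivWithinAt ℝ F K (0, t) := by
    refine (hf _ hx).isSymmSndFDerivWithinAt (by simpa using two_le_infty) hU ?_ hx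
    rw [hK, interior_prod_eq, interior_Ico, interior_Ioo, closure_prod_eq,
      closure_Ioo (by linarith), closure_Ioo ht₁.ne]
    exact ⟨Ioo_subset_Icc_self h0, Ico_subset_Icc_self ht⟩
  -- the time derivative of the variation
  have h1 : ∀ r ∈ Ico 0 t₁, deriv (fun s => f s r) 0 = fderivWithin ℝ F K (0, r) (1, 0) := by
    intro r hr
    exact (hasDerivAt_comp_of_mapsTo (c := fun s : ℝ => (s, r)) hI (hd _ ⟨h0, hr⟩)
      ((hasDerivAt_id _).prodMk (hasDerivAt_const _ _)) fun s hs => ⟨hs, hr⟩).deriv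
  have h2 : HasDerivWithinAt (fun r => fderivWithin ℝ F K (0, r) (1, 0))
      (fderivWithin ℝ (fderivWithin ℝ F K) K (0, t) (0, 1) (1, 0)) (Ico 0 t₁) t := by
    have hc : HasDerivWithinAt (fun r : ℝ => ((0 : ℝ), r)) ((0 : ℝ), (1 : ℝ)) (Ico 0 t₁) t :=
      (hasDerivWithinAt_const _ _ _).prodMk (hasDerivWithinAt_id _ _)
    have hm : MapsTo (fun r : ℝ => ((0 : ℝ), r)) (Ico 0 t₁) K := fun r hr => ⟨h0, hr⟩
    have h := (hd2 _ hx).hasFDerivWithinAt.comp_hasDerivWithinAt t hc hm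
    simpa using h.clm_apply (hasDerivWithinAt_const t (Ico 0 t₁) ((1 : ℝ), (0 : ℝ)))
  -- the variation of the time derivative
  have h3 : ∀ s ∈ Ioo (-δ) δ, a s = fderivWithin ℝ F K (s, t) (0, 1) := by
    intro s hs
    have hc : HasDerivWithinAt (fun r : ℝ => (s, r)) ((0 : ℝ), (1 : ℝ)) (Ico 0 t₁) t :=
      (hasDerivWithinAt_const _ _ _).prodMk (hasDerivWithinAt_id _ _)
    have hm : MapsTo (fun r : ℝ => (s, r)) (Ico 0 t₁) K := fun r hr => ⟨hs, hr⟩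
    have h := (hd _ (hm ht)).hasFDerivWithinAt.comp_hasDerivWithinAt t hc hm
    exact (uniqueDiffOn_Ico _ _ t ht).eq_deriv _ (ha s hs) h
  have h4 : HasDerivAt (fun s => fderivWithin ℝ F K (s, t) (0, 1))
      (fderivWithin ℝ (fderivWithin ℝ F K) K (0, t) (1, 0) (0, 1)) 0 := by
    have hc : HasDerivWithinAt (fun s : ℝ => (s, t)) ((1 : ℝ), (0 : ℝ)) (Ioo (-δ) δ) 0 :=
      (hasDerivWithinAt_id _ _).prodMk (hasDerivWithinAt_const _ _ _)
    have hm : MapsTo (fun s : ℝ => (s, t)) (Ioo (-δ) δ) K := fun s hs => ⟨hs, ht⟩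
    have h := (hd2 _ hx).hasFDerivWithinAt.comp_hasDerivWithinAt (0 : ℝ) hc hm
    have h' := h.clm_apply (hasDerivWithinAt_const (0 : ℝ) (Ioo (-δ) δ) ((0 : ℝ), (1 : ℝ)))
    exact HasDerivWithinAt.hasDerivAt (by simpa using h') hI
  have h5 : a' = fderivWithin ℝ (fderivWithin ℝ F K) K (0, t) (0, 1) (1, 0) := by
    rw [hsymm.eq]
    refine ha'.unique (h4.congr_of_eventuallyEq ?_)
    filter_upwards [hI] with s hs using h3 s hs
  rw [h5]
  exact h2.congr h1 (h1 t ht)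

variable {n : ℕ} {M : Type*} [TopologicalSpace M] [ChartedSpace (Coord n) M]

lemma SmoothFamilyOn.mono {P : Type*} [NormedAddCommGroup P] [NormedSpace ℝ P] {S S' : Set P}
    {h : P → TwoTensor n M} (hS : SmoothFamilyOn S h) (hss : S' ⊆ S) : SmoothFamilyOn S' h :=
  fun φ hφ i j => (hS φ hφ i j).mono (prod_mono hss subset_rfl)

lemma mem_timeInterval_of_lt {T : EReal} {t t₁ : ℝ} (ht₁ : (t₁ : EReal) < T)
    (ht : t ∈ Ico 0 t₁) : t ∈ timeInterval T :=
  ⟨ht.1, (EReal.coe_lt_coe_iff.mpr ht.2).trans ht₁⟩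

lemma Ico_mem_nhdsWithin_timeInterval {T : EReal} {t t₁ : ℝ} (h : t < t₁) :
    Ico 0 t₁ ∈ 𝓝[timeInterval T] t := by
  filter_upwards [self_mem_nhdsWithin, mem_nhdsWithin_of_mem_nhds (Iio_mem_nhds h)] with r hr hr'
    using ⟨hr.1, hr'⟩

/-- The expansion of a `2`-tensor in the coordinate basis. -/
lemma components_apply_apply (φ : OpenPartialHomeomorph M (Coord n)) (h : TwoTensor n M)
    (y u v : Coord n) :
    h (φ.symm y) (mfderiv (𝓡 n) (𝓡 n) φ.symm y u) (mfderiv (𝓡 n) (𝓡 n) φ.symm y v) =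
      ∑ i, ∑ j, u i * v j * components φ h y i j := by
  have hsum : ∀ w : Coord n, w = ∑ i, w i • (EuclideanSpace.single i 1 : Coord n) := by
    intro w
    ext k
    simp [Finset.sum_apply, Pi.single_apply]
  -- tangent spaces are copies of the model space `Coord n`
  let D : Coord n →L[ℝ] Coord n := mfderiv (𝓡 n) (𝓡 n) φ.symm y
  let L : Coord n →L[ℝ] Coord n →L[ℝ] ℝ := h (φ.symm y)
  change L (D u) (D v) = ∑ i, ∑ j, u i * v j *
    L (D (EuclideanSpace.single i 1)) (D (EuclideanSpace.single j 1))
  conv_lhs => rw [hsum u, hsum v]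
  simp only [map_sum, map_smul, FunLike.coe_sum, Finset.sum_apply,
    FunLike.coe_smul, Pi.smul_apply, smul_eq_mul, Finset.mul_sum]
  rw [Finset.sum_comm]
  exact Finset.sum_congr rfl fun i _ => Finset.sum_congr rfl fun j _ => by ring

lemma mfderiv_symm_bijective {φ : OpenPartialHomeomorph M (Coord n)}
    (hφ : φ ∈ IsManifold.maximalAtlas (𝓡 n) ∞ M) {y : Coord n} (hy : y ∈ φ.target) :
    Function.Bijective (mfderiv (𝓡 n) (𝓡 n) φ.symm y) := by
  have h : φ.MDifferentiable (𝓡 n) (𝓡 n) :=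
    ⟨(contMDiffOn_of_mem_maximalAtlas hφ).mdifferentiableOn (by simp),
      (contMDiffOn_symm_of_mem_maximalAtlas hφ).mdifferentiableOn (by simp)⟩
  exact h.symm.mfderiv_bijective hy

variable [IsManifold (𝓡 n) ∞ M]

lemma components_inner_symm (φ : OpenPartialHomeomorph M (Coord n)) (g : RMetric n M)
    (y : Coord n) (i j : Fin n) : components φ g.inner y i j = components φ g.inner y j i :=
  g.symm _ _ _

/-- The components of a Riemannian metric are invertible, by positivity and since the coordinate
vectors are a basis. -/
lemma isUnit_det_components {φ : OpenPartialHomeomorph M (Coord n)}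
    (hφ : φ ∈ IsManifold.maximalAtlas (𝓡 n) ∞ M) (g : RMetric n M) {y : Coord n}
    (hy : y ∈ φ.target) : IsUnit (components φ g.inner y).det := by
  rw [isUnit_iff_ne_zero]
  intro h0
  obtain ⟨c, hc, hc0⟩ := Matrix.exists_mulVec_eq_zero_iff.mpr h0
  set u : Coord n := WithLp.toLp 2 c with hu
  have h1 : g.inner (φ.symm y) (mfderiv (𝓡 n) (𝓡 n) φ.symm y u)
      (mfderiv (𝓡 n) (𝓡 n) φ.symm y u) = 0 := by
    rw [components_apply_apply]
    have h2 : ∀ i, ∑ j, components φ g.inner y i j * c j = 0 := fun i => congrFun hc0 i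
    have h3 : ∀ i, ∑ j, u i * u j * components φ g.inner y i j = 0 := by
      intro i
      rw [← mul_zero (u i), ← h2 i, Finset.mul_sum]
      exact Finset.sum_congr rfl fun j _ => by simp only [hu]; ring
    simp [h3]
  have h4 : mfderiv (𝓡 n) (𝓡 n) φ.symm y u = 0 := by
    by_contra h
    exact (g.pos _ _ h).ne' h1
  have h5 : u = 0 := (mfderiv_symm_bijective hφ hy).injective (h4.trans (map_zero _).symm)
  exact hc (by simpa [hu] using congrArg WithLp.ofLp h5)

section Family

variable {δ t₁ t : ℝ} {g : ℝ → ℝ → RMetric n M} {φ : OpenPartialHomeomorph M (Coord n)}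

lemma contDiffOn_components_slice
    (hg : SmoothFamilyOn (Ioo (-δ) δ ×ˢ Ico 0 t₁) (fun p : ℝ × ℝ => (g p.1 p.2).inner))
    (hφ : φ ∈ IsManifold.maximalAtlas (𝓡 n) ∞ M) (ht : t ∈ Ico 0 t₁) (i j : Fin n) :
    ContDiffOn ℝ ∞ (fun q : ℝ × Coord n => components φ (g q.1 t).inner q.2 i j)
      (Ioo (-δ) δ ×ˢ φ.target) :=
  (hg φ hφ i j).comp (f := fun q : ℝ × Coord n => ((q.1, t), q.2))
    ((contDiff_fst.prodMk contDiff_const).prodMk contDiff_snd).contDiffOn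
    fun _ hq => ⟨⟨hq.1, ht⟩, hq.2⟩

lemma isMetricOn_components
    (hg : SmoothFamilyOn (Ioo (-δ) δ ×ˢ Ico 0 t₁) (fun p : ℝ × ℝ => (g p.1 p.2).inner))
    (hφ : φ ∈ IsManifold.maximalAtlas (𝓡 n) ∞ M) (ht : t ∈ Ico 0 t₁) {s : ℝ}
    (hs : s ∈ Ioo (-δ) δ) : IsMetricOn φ.target (components φ (g s t).inner) where
  isOpen := φ.open_target
  smooth i j z hz := by
    have hm : MapsTo (fun w : Coord n => (s, w)) φ.target (Ioo (-δ) δ ×ˢ φ.target) :=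
      fun w hw => ⟨hs, hw⟩
    have h := (contDiffOn_components_slice hg hφ ht i j).comp
      (contDiff_const.prodMk contDiff_id).contDiffOn hm
    exact h.contDiffAt (φ.open_target.mem_nhds hz)
  symm z _ i j := components_inner_symm φ _ z i j
  unit z hz := isUnit_det_components hφ _ hz

/-- The variation of the family of metrics exists at every point of the manifold. -/
lemma hasDerivAt_inner (hδ : 0 < δ)
    (hg : SmoothFamilyOn (Ioo (-δ) δ ×ˢ Ico 0 t₁) (fun p : ℝ × ℝ => (g p.1 p.2).inner))
    (ht : t ∈ Ico 0 t₁) (x : M) :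
    HasDerivAt (fun s => (g s t).inner x) (variation g t x) 0 := by
  obtain ⟨φ, hφ, y, hy, rfl⟩ : ∃ φ ∈ IsManifold.maximalAtlas (𝓡 n) ∞ M,
      ∃ y ∈ φ.target, φ.symm y = x :=
    ⟨_, IsManifold.chart_mem_maximalAtlas x, _, mem_chart_target _ x,
      (chartAt (Coord n) x).left_inv (mem_chart_source _ x)⟩
  -- the tangent space at a point is a copy of `Coord n`, which carries a norm
  let A : ℝ → Coord n →L[ℝ] Coord n →L[ℝ] ℝ := fun s => (g s t).inner (φ.symm y)
  let D : Coord n →L[ℝ] Coord n := mfderiv (𝓡 n) (𝓡 n) φ.symm y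
  have hD : Function.Surjective D := (mfderiv_symm_bijective hφ hy).surjective
  have hA : HasDerivAt A (deriv A 0) 0 := by
    refine hasDerivAt_clm_of_contDiffOn_apply
      (Ioo_mem_nhds (by linarith) hδ : Ioo (-δ) δ ∈ 𝓝 (0 : ℝ)) fun X Y => ?_
    obtain ⟨u, rfl⟩ := hD X
    obtain ⟨v, rfl⟩ := hD Y
    have h : ∀ s, A s (D u) (D v) =
        ∑ i, ∑ j, u i * v j * components φ (g s t).inner y i j :=
      fun s => components_apply_apply φ _ y u v
    refine ContDiffOn.congr ?_ fun s _ => h s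
    refine ContDiffOn.sum fun i _ => ContDiffOn.sum fun j _ => contDiffOn_const.mul ?_
    exact (contDiffOn_components_slice hg hφ ht i j).comp (f := fun s : ℝ => (s, y))
      (contDiff_id.prodMk contDiff_const).contDiffOn fun s hs => ⟨hs, hy⟩
  exact hA

lemma hasDerivAt_inner_apply (hδ : 0 < δ)
    (hg : SmoothFamilyOn (Ioo (-δ) δ ×ˢ Ico 0 t₁) (fun p : ℝ × ℝ => (g p.1 p.2).inner))
    (ht : t ∈ Ico 0 t₁) (x : M) (X Y : TangentSpace (𝓡 n) x) :
    HasDerivAt (fun s => (g s t).inner x X Y) (variation g t x X Y) 0 :=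
  hasDerivAt_clm_apply_apply (V := Coord n) (hasDerivAt_inner hδ hg ht x) X Y

lemma hasDerivAt_components (hδ : 0 < δ)
    (hg : SmoothFamilyOn (Ioo (-δ) δ ×ˢ Ico 0 t₁) (fun p : ℝ × ℝ => (g p.1 p.2).inner))
    (ht : t ∈ Ico 0 t₁) (φ : OpenPartialHomeomorph M (Coord n)) (y : Coord n) (i j : Fin n) :
    HasDerivAt (fun s => components φ (g s t).inner y i j)
      (components φ (variation g t) y i j) 0 :=
  hasDerivAt_inner_apply hδ hg ht _ _ _

lemma variation_symm (hδ : 0 < δ)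
    (hg : SmoothFamilyOn (Ioo (-δ) δ ×ˢ Ico 0 t₁) (fun p : ℝ × ℝ => (g p.1 p.2).inner))
    (ht : t ∈ Ico 0 t₁) (x : M) (X Y : TangentSpace (𝓡 n) x) :
    variation g t x X Y = variation g t x Y X := by
  refine (hasDerivAt_inner_apply hδ hg ht x X Y).unique ?_
  simp only [(g _ t).symm x X Y]
  exact hasDerivAt_inner_apply hδ hg ht x Y X

lemma hasVariation_components (hδ : 0 < δ)
    (hg : SmoothFamilyOn (Ioo (-δ) δ ×ˢ Ico 0 t₁) (fun p : ℝ × ℝ => (g p.1 p.2).inner))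
    (hφ : φ ∈ IsManifold.maximalAtlas (𝓡 n) ∞ M) (ht : t ∈ Ico 0 t₁) (i j : Fin n) :
    HasVariation φ.target (fun s z => components φ (g s t).inner z i j)
      (fun z => components φ (variation g t) z i j) where
  smooth z hz := (contDiffOn_components_slice hg hφ ht i j).contDiffAt
    (prod_mem_nhds (Ioo_mem_nhds (by linarith) hδ) (φ.open_target.mem_nhds hz))
  deriv z _ := hasDerivAt_components hδ hg ht φ z i j

/-- The variation is smooth in time, up to `t = 0`, and space. -/
lemma smoothFamilyOn_variation (hδ : 0 < δ)
    (hg : SmoothFamilyOn (Ioo (-δ) δ ×ˢ Ico 0 t₁) (fun p : ℝ × ℝ => (g p.1 p.2).inner)) :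
    SmoothFamilyOn (Ico 0 t₁) (variation g) := by
  intro φ hφ i j
  set F : (ℝ × ℝ) × Coord n → ℝ := fun q => components φ (g q.1.1 q.1.2).inner q.2 i j
  set K : Set ((ℝ × ℝ) × Coord n) := (Ioo (-δ) δ ×ˢ Ico 0 t₁) ×ˢ φ.target
  have hF : ContDiffOn ℝ ∞ F K := hg φ hφ i j
  have hU : UniqueDiffOn ℝ K := ((uniqueDiffOn_Ioo _ _).prod (uniqueDiffOn_Ico _ _)).prod
    φ.open_target.uniqueDiffOn
  have h0 : (0 : ℝ) ∈ Ioo (-δ) δ := ⟨by linarith, hδ⟩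
  have h1 : ContDiffOn ℝ ∞ (fun q : ℝ × Coord n => fderivWithin ℝ F K ((0, q.1), q.2) ((1, 0), 0))
      (Ico 0 t₁ ×ˢ φ.target) := by
    refine ContDiffOn.clm_apply ?_ contDiffOn_const
    exact (hF.fderivWithin hU (m := ∞) (by simp)).comp
      (f := fun q : ℝ × Coord n => (((0 : ℝ), q.1), q.2))
      ((contDiff_const.prodMk contDiff_fst).prodMk contDiff_snd).contDiffOn
      fun q hq => ⟨⟨h0, hq.1⟩, hq.2⟩
  refine h1.congr fun q hq => ?_
  have h2 := hasDerivAt_comp_of_mapsTo (f := F) (K := K)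
    (c := fun s : ℝ => ((s, q.1), q.2)) (w := ((1, 0), 0))
    (Ioo_mem_nhds (by linarith) hδ : Ioo (-δ) δ ∈ 𝓝 (0 : ℝ))
    (hF.differentiableOn (by simp) _ ⟨⟨h0, hq.1⟩, hq.2⟩)
    (((hasDerivAt_id _).prodMk (hasDerivAt_const _ _)).prodMk (hasDerivAt_const _ _))
    fun s hs => ⟨⟨hs, hq.1⟩, hq.2⟩
  exact (hasDerivAt_components hδ hg hq.1 φ q.2 i j).unique h2

/-- The Lichnerowicz heat equation for the variation: the modified Ricci flow equation is
differentiated in the parameter, and the order of the derivatives is exchanged. -/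
lemma hasDerivWithinAt_components_variation (hδ : 0 < δ)
    (hg : SmoothFamilyOn (Ioo (-δ) δ ×ˢ Ico 0 t₁) (fun p : ℝ × ℝ => (g p.1 p.2).inner))
    {T : ℝ → EReal} (hT : ∀ s ∈ Ioo (-δ) δ, (t₁ : EReal) < T s)
    (hMRF : ∀ s ∈ Ioo (-δ) δ, IsModifiedRicciFlow (T s) (g 0) (g s))
    (hφ : φ ∈ IsManifold.maximalAtlas (𝓡 n) ∞ M) (ht : t ∈ Ico 0 t₁) {y : Coord n}
    (hy : y ∈ φ.target) (i j : Fin n) :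
    HasDerivWithinAt (fun r => components φ (variation g r) y i j)
      (lichnerowicz (components φ (g 0 t).inner) (components φ (variation g t)) i j y)
      (Ico 0 t₁) t := by
  have hI : Ioo (-δ) δ ∈ 𝓝 (0 : ℝ) := Ioo_mem_nhds (by linarith) hδ
  have h1 := hasDerivAt_modifiedRicci (F := fun s => components φ (g s t).inner)
    (h := components φ (variation g t))
    (by filter_upwards [hI] with s hs using isMetricOn_components hg hφ ht hs)
    (hasVariation_components hδ hg hφ ht)
    (fun z _ i j => variation_symm hδ hg ht _ _ _) hy i j
  have h2 := hasDerivWithinAt_deriv_comm (f := fun s r => components φ (g s r).inner y i j)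
    hδ ht ((hg φ hφ i j).comp (f := fun p : ℝ × ℝ => (p, y))
      (contDiff_id.prodMk contDiff_const).contDiffOn fun p hp => ⟨hp, hy⟩)
    (fun s hs => ((hMRF s hs).equation φ hφ y hy t (mem_timeInterval_of_lt (hT s hs) ht) i j).mono
      fun r hr => mem_timeInterval_of_lt (hT s hs) hr) h1
  exact h2.congr (fun r hr => (hasDerivAt_components hδ hg hr φ y i j).deriv.symm)
    (hasDerivAt_components hδ hg ht φ y i j).deriv.symm

end Family

/-- Near `s = 0` and a given time, the family is defined on a product of intervals. -/
lemma exists_box {ε : ℝ} (hε : 0 < ε) {T : ℝ → EReal} {T' : EReal}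
    (hT' : ∀ t ∈ timeInterval T', ∀ᶠ s in 𝓝 (0 : ℝ), (t : EReal) < T s) {t : ℝ}
    (ht : t ∈ timeInterval T') :
    ∃ δ t₁ : ℝ, 0 < δ ∧ δ ≤ ε ∧ t < t₁ ∧ ∀ s ∈ Ioo (-δ) δ, (t₁ : EReal) < T s := by
  obtain ⟨t₁, h1, h2⟩ := EReal.lt_iff_exists_real_btwn.mp ht.2
  have h1' : t < t₁ := EReal.coe_lt_coe_iff.mp h1
  obtain ⟨δ, hδ, h⟩ := Metric.eventually_nhds_iff.mp (hT' t₁ ⟨ht.1.trans h1'.le, h2⟩)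
  refine ⟨min δ ε, t₁, lt_min hδ hε, min_le_right _ _, h1', fun s hs => h ?_⟩
  rw [Real.dist_eq, sub_zero, abs_lt]
  exact ⟨by linarith [hs.1, min_le_left δ ε], hs.2.trans_le (min_le_left _ _)⟩

end

end LinRF

end

open LinRF in
theorem mainTheorem3 {n : ℕ} {M : Type*} [TopologicalSpace M] [T2Space M]
    [ChartedSpace (EuclideanSpace ℝ (Fin n)) M] [IsManifold (𝓡 n) ∞ M]
    -- `g s t`, for `|s| < ε` and `t ∈ [0, T s)`, is the family `g_s(t)`
    (ε : ℝ) (hε : 0 < ε) (T : ℝ → EReal) (g : ℝ → ℝ → RMetric n M)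
    (hT_pos : ∀ s ∈ Ioo (-ε) ε, 0 < T s)
    -- the background metrics `g 0 t` are defined as long as they are needed
    (hT_le : ∀ s ∈ Ioo (-ε) ε, T s ≤ T 0)
    -- the family is smooth in `s`, `t` and the point of `M`
    (hsmooth : SmoothFamilyOn {p : ℝ × ℝ | p.1 ∈ Ioo (-ε) ε ∧ p.2 ∈ timeInterval (T p.1)}
      (fun p => (g p.1 p.2).inner))
    -- `g 0` is a solution of the Ricci flow
    (hRF : IsRicciFlow (T 0) (g 0))
    -- each `g s` solves the modified Ricci flow with background metrics `g 0 t`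
    (hMRF : ∀ s ∈ Ioo (-ε) ε, IsModifiedRicciFlow (T s) (g 0) (g s))
    -- `[0, T')` is a time interval on which the variation makes sense
    (T' : EReal) (hT' : ∀ t ∈ timeInterval T', ∀ᶠ s in 𝓝 (0 : ℝ), (t : EReal) < T s) :
    (∀ t ∈ timeInterval T', ∀ x : M,
      HasDerivAt (fun s => (g s t).inner x) (variation g t x) 0) ∧
    IsLichnerowiczHeatSolution T' (g 0) (variation g) ∧
    IsRicciFlow T' (g 0) ∧
    ((∀ t ∈ timeInterval T', IsCompleteMetric (g 0 t)) →
      IsLinearizedRicciFlow T' (g 0) (variation g)) := by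
  -- every time in `[0, T')` lies in a product of intervals on which the family is smooth
  have hbox : ∀ t ∈ timeInterval T', ∃ δ t₁ : ℝ, 0 < δ ∧ t ∈ Ico 0 t₁ ∧
      (∀ s ∈ Ioo (-δ) δ, (t₁ : EReal) < T s) ∧
      (∀ s ∈ Ioo (-δ) δ, IsModifiedRicciFlow (T s) (g 0) (g s)) ∧
      SmoothFamilyOn (Ioo (-δ) δ ×ˢ Ico 0 t₁) (fun p : ℝ × ℝ => (g p.1 p.2).inner) := by
    intro t ht
    obtain ⟨δ, t₁, hδ, hδε, htt₁, hT⟩ := exists_box hε hT' ht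
    have hsub : Ioo (-δ) δ ⊆ Ioo (-ε) ε := Ioo_subset_Ioo (by linarith) hδε
    exact ⟨δ, t₁, hδ, ⟨ht.1, htt₁⟩, hT, fun s hs => hMRF s (hsub hs),
      hsmooth.mono fun p hp => ⟨hsub hp.1, mem_timeInterval_of_lt (hT _ hp.1) hp.2⟩⟩
  have hheat : IsLichnerowiczHeatSolution T' (g 0) (variation g) := by
    refine ⟨fun φ hφ i j => ?_, fun t ht x X Y => ?_, fun φ hφ y hy t ht i j => ?_⟩
    · rintro ⟨t, y⟩ ⟨ht, hy⟩
      obtain ⟨δ, t₁, hδ, htt₁, -, -, hg⟩ := hbox t ht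
      refine (smoothFamilyOn_variation hδ hg φ hφ i j (t, y) ⟨htt₁, hy⟩).mono_of_mem_nhdsWithin ?_
      rw [nhdsWithin_prod_eq]
      exact prod_mem_prod (Ico_mem_nhdsWithin_timeInterval htt₁.2) self_mem_nhdsWithin
    · obtain ⟨δ, t₁, hδ, htt₁, -, -, hg⟩ := hbox t ht
      exact variation_symm hδ hg htt₁ x X Y
    · obtain ⟨δ, t₁, hδ, htt₁, hT, hM, hg⟩ := hbox t ht
      have h := hasDerivWithinAt_components_variation hδ hg hT hM hφ htt₁ hy i j
      exact h.mono_of_mem_nhdsWithin (Ico_mem_nhdsWithin_timeInterval htt₁.2)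
  have hsub : timeInterval T' ⊆ timeInterval (T 0) :=
    fun t ht => ⟨ht.1, (hT' t ht).self_of_nhds⟩
  have hRF' : IsRicciFlow T' (g 0) :=
    ⟨hRF.smooth.mono hsub, fun φ hφ y hy t ht i j =>
      (hRF.equation φ hφ y hy t (hsub ht) i j).mono hsub⟩
  refine ⟨fun t ht x => ?_, hheat, hRF', fun hc => ⟨hc, hRF', hheat⟩⟩
  obtain ⟨δ, t₁, hδ, htt₁, -, -, hg⟩ := hbox t ht
  exact hasDerivAt_inner hδ hg htt₁ x
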